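/- Let $N\ge 1$ and $d\ge 1$. For a partition $\mu\vdash N$ let $S^\mu$ be the irreducible complex representation (Specht module) of the symmetric group $S(N)$ labelled by $\mu$, with character $\chi^\mu$ and dimension $d_\mu$. Let $V$ be the representation of $S(N)$ on $(\mathbb C^d)^{\otimes N}$ that permutes the tensor factors, let $m_\mu$ be the multiplicity of $S^\mu$ in $V$, and let $P_\mu=\frac{d_\mu}{N!}\sum_{\sigma\in S(N)}\chi^\mu(\sigma^{-1})V(\sigma)$ be the Young projector. The teleportation matrix $M_F$ is the real matrix indexed by the partitions of $N$ with at most $d$ parts whose entry $(M_F)_{\mu\nu}$ is the number of Young frames with $N-1$ boxes that can be obtained both from $\mu$ and from $\nu$ by removing one box. Let $v=(v_\mu)$ be an eigenvector of $M_F$ for its maximal eigenvalue, with $v_\mu\ge 0$ and $\sum_\mu v_\mu^2=1$. Let $|\Phi^+\rangle_{AB}=\bigotimes_{a=1}^N|\psi^+\rangle_{A_aB_a}$, where $|\psi^+\rangle=\frac1{\sqrt d}\sum_{x=1}^d|x\rangle|x\rangle$, be the resource state of non-optimal port-based teleportation (PBT), and let $$|\Phi\rangle_{AB}=(O_A\otimes\mathbf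 1_B)|\Phi^+\rangle_{AB},\qquad O_A=\sqrt{d^N}\sum_{\mu}\frac{v_\mu}{\sqrt{d_\mu m_\mu}}P_\mu,$$ be the resource state of optimal PBT, where the sum is over $\mu\vdash N$ with at most $d$ parts. With the fidelity $F(|\varphi\rangle,|\psi\rangle)=|\langle\varphi|\psi\rangle|$ of pure states, $$F(|\Phi^+\rangle_{AB},|\Phi\rangle_{AB})=\frac1{\sqrt{d^N}}\sum_{\mu}v_\mu\sqrt{d_\mu m_\mu},$$ where again $\mu$ runs over the partitions of $N$ with at most $d$ parts. In the qubit case $d=2$, for $0\le l\le\lfloor N/2\rfloor$ the entry of $v$ at $\mu=(N-l,l)$ is $v^{(N)}_l=u_l/\big(\sum_{k=0}^{\lfloor N/2\rfloor}u_k^2\big)^{1/2}$, where $$u_l=\begin{cases}(-1)^{\frac N2-l}\Big(\sin\frac{(\frac{N+2}2-l)N\pi}{N+2}-\sin\frac{(\frac N2-l)N\pi}{N+2}\Big)\Big/\sin\frac{N\pi}{N+2},& N\text{ even},\\[1ex](-1)^{\frac{N-1}2-l}\sin\frac{(\frac{N+1}2-l)N\pi}{N+2}\Big/\sin\frac{N\pi}{N+2},&N\text{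 odd},\end{cases}$$ and $$F(|\Phi^+\rangle_{AB},|\Phi\rangle_{AB})=\frac1{\sqrt{2^N}}\sum_{l=0}^{\lfloor N/2\rfloor}v_l^{(N)}\frac{N-2l+1}{\sqrt{N+1}}\sqrt{\binom{N+1}{l}}.$$ Equivalently, $$F(|\Phi^+\rangle_{AB},|\Phi\rangle_{AB})=\sqrt{\frac{N!}{2^{N-2}(N+2)}}\sum_{j=j_{\min}}^{N/2}\frac{(2j+1)\sin\frac{\pi(2j+1)}{N+2}}{\sqrt{(\frac N2-j)!\,(\frac N2+j+1)!}},$$ where $j$ runs in unit steps and $j_{\min}=0$ for $N$ even, $j_{\min}=\frac12$ for $N$ odd. -/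

import Mathlib

open scoped Kronecker

noncomputable section

namespace PBT

/-! ### Young frames -/

/-- The Young diagram of a partition: its row lengths are the parts in decreasing order. -/
def diagram {n : ℕ} (μ : n.Partition) : YoungDiagram :=
  YoungDiagram.ofRowLens (μ.parts.sort (· ≥ ·)) (μ.parts.pairwise_sort (· ≥ ·)).sortedGE

/-- Young frames with `N` boxes and height at most `d`: the irreps of `S(N)` that occur
in `(ℂ^d)^{⊗N}`. -/
abbrev Frame (N d : ℕ) : Type := {μ : N.Partition // μ.parts.card ≤ d}

/-- The frame `(N - l, l)`; the second row is absent for `l = 0`. -/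
def twoRow (N l : ℕ) (hl : 2 * l ≤ N) : Frame N 2 :=
  ⟨Nat.Partition.ofSums N {N - l, l} (by
      simp only [Multiset.insert_eq_cons, Multiset.sum_cons, Multiset.sum_singleton]; omega),
    Multiset.card_le_card (Multiset.filter_le _ ({N - l, l} : Multiset ℕ))⟩

/-! ### Representations of the symmetric group -/

/-- The permutation representation `V` of `S(N)` on complex functions on words of length `N`
over `κ`, determined by `V(σ) e_i = e_{i ∘ σ⁻¹}`. For `κ = Fin d` this is `(ℂ^d)^{⊗N}` in its
computational basis. -/
def permRep (N : ℕ) (κ : Type) :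
    Representation ℂ (Equiv.Perm (Fin N)) ((Fin N → κ) → ℂ) where
  toFun σ := LinearMap.funLeft ℂ ℂ (fun i => i ∘ σ)
  map_one' := by ext; rfl
  map_mul' σ τ := by ext; rfl

/-- Young tableaux of shape `μ`: bijective fillings, sending each number to its box
`(row, column)`. -/
abbrev Tableau {N : ℕ} (μ : N.Partition) : Type := Fin N ≃ (diagram μ).cells

/-- The polytabloid `e_t = ∑ sgn(σ) V(σ) {t}`, summed over the column stabiliser of `t`. The
tabloid `{t}` is the word that records the row of every entry of `t`. -/
def polytabloid {N : ℕ} {μ : N.Partition} (t : Tableau μ) : (Fin N → ℕ) → ℂ :=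
  ∑ σ : Equiv.Perm (Fin N) with ∀ i, (t (σ i)).1.2 = (t i).1.2,
    ((Equiv.Perm.sign σ : ℤ) : ℂ) • permRep N ℕ σ (Pi.single (fun i => (t i).1.1) 1)

theorem permRep_single {N : ℕ} {κ : Type} [DecidableEq κ] (σ : Equiv.Perm (Fin N))
    (w : Fin N → κ) :
    permRep N κ σ (Pi.single w 1) = Pi.single (w ∘ σ.symm) 1 := by
  funext i
  have h : i ∘ σ = w ↔ i = w ∘ σ.symm := by
    constructor
    · rintro rfl; funext x; simp
    · rintro rfl; funext x; simp
  simp only [permRep, MonoidHom.coe_mk, OneHom.coe_mk, LinearMap.funLeft_apply, Pi.single_apply, h]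

theorem permRep_polytabloid {N : ℕ} {μ : N.Partition} (π : Equiv.Perm (Fin N)) (t : Tableau μ) :
    permRep N ℕ π (polytabloid t) = polytabloid (π.symm.trans t) := by
  unfold polytabloid
  rw [map_sum]
  refine Finset.sum_bij' (fun σ _ => π * σ * π⁻¹) (fun σ _ => π⁻¹ * σ * π) ?_ ?_ ?_ ?_ ?_
  · intro σ hσ
    simp only [Finset.mem_filter, Finset.mem_univ, true_and] at hσ ⊢
    intro i
    simpa using hσ (π.symm i)
  · intro σ hσ
    simp only [Finset.mem_filter, Finset.mem_univ, true_and] at hσ ⊢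
    intro i
    simpa using hσ (π i)
  · intro σ _; group
  · intro σ _; group
  · intro σ _
    rw [map_smul]
    congr 1
    · simp only [map_mul, map_inv]
      rw [mul_comm, ← mul_assoc]; simp
    · simp only [permRep_single]
      congr 1
      funext i
      have h : (π * σ * π⁻¹).symm i = π (σ.symm (π.symm i)) := rfl
      simp only [Function.comp_apply, Equiv.trans_apply, h, Equiv.symm_apply_apply]

/-- The Specht module `S^μ`, the irrep of `S(N)` labelled by `μ`. -/
def specht {N : ℕ} (μ : N.Partition) : Subrepresentation (permRep N ℕ) where
  toSubmodule := Submodule.span ℂ (Set.range (polytabloid (μ := μ)))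
  apply_mem_toSubmodule π := by
    intro x hx
    induction hx using Submodule.span_induction with
    | mem x hx =>
      obtain ⟨t, rfl⟩ := hx
      rw [permRep_polytabloid]
      exact Submodule.subset_span ⟨_, rfl⟩
    | zero => rw [map_zero]; exact Submodule.zero_mem _
    | add x y _ _ hx hy => rw [map_add]; exact Submodule.add_mem _ hx hy
    | smul a x _ hx => rw [map_smul]; exact Submodule.smul_mem _ a hx

/-- `d_μ`, the dimension of the irrep `μ` of `S(N)`. -/
def dimIrrep {N : ℕ} (μ : N.Partition) : ℕ :=
  Module.finrank ℂ (specht μ).toSubmodule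

/-- `m_μ`, the multiplicity of the irrep `μ` in `(ℂ^d)^{⊗N}`: the dimension of the space of
`S(N)`-equivariant maps from the irrep to `(ℂ^d)^{⊗N}`. -/
def multIrrep {N : ℕ} (d : ℕ) (μ : N.Partition) : ℕ :=
  Module.finrank ℂ
    (Representation.IntertwiningMap (specht μ).toRepresentation (permRep N (Fin d)))

/-- The Young projector `P_μ = (d_μ / N!) ∑_σ χ^μ(σ⁻¹) V(σ)`, in the computational basis. -/
def youngProj {N : ℕ} (d : ℕ) (μ : N.Partition) :
    Matrix (Fin N → Fin d) (Fin N → Fin d) ℂ :=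
  ((dimIrrep μ : ℂ) / (N.factorial : ℂ)) •
    ∑ σ : Equiv.Perm (Fin N),
      (specht μ).toRepresentation.character σ⁻¹ • LinearMap.toMatrix' (permRep N (Fin d) σ)

/-! ### The teleportation matrix -/

/-- The teleportation matrix: the `(μ, ν)` entry is the number of Young frames with `N - 1` boxes
that arise from both `μ` and `ν` by removing one box. On the diagonal this is the number of
removable boxes of `μ`; off the diagonal it is `1` if `ν` arises from `μ` by moving one box and
`0` otherwise. -/
def teleportationMatrix (N d : ℕ) : Matrix (Frame N d) (Frame N d) ℝ :=
  fun μ ν => (Nat.card {α : (N - 1).Partition //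
    diagram α ≤ diagram μ.1 ∧ diagram α ≤ diagram ν.1} : ℝ)

/-- `v` is an entrywise nonnegative, normalised eigenvector of the teleportation matrix for its
maximal eigenvalue. -/
structure IsOptimalVector {N d : ℕ} (v : Frame N d → ℝ) : Prop where
  nonneg : ∀ μ, 0 ≤ v μ
  normalised : ∑ μ, v μ ^ 2 = 1
  eigenvector : ∃ lam : ℝ,
    Module.End.HasEigenvector (Matrix.toLin' (teleportationMatrix N d)) lam v ∧
    ∀ lam' : ℝ, Module.End.HasEigenvalue (Matrix.toLin' (teleportationMatrix N d)) lam' →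
      lam' ≤ lam

/-! ### Resource states -/

/-- The maximally entangled state `|ψ⁺⟩ = d^{-1/2} ∑_x |x⟩|x⟩` on `ℂ^d ⊗ ℂ^d`. -/
def maxEntangled (d : ℕ) : Fin d × Fin d → ℂ :=
  fun p => if p.1 = p.2 then ((1 / √(d : ℝ) : ℝ) : ℂ) else 0

/-- The resource state `|Φ⁺⟩ = ⨂_a |ψ⁺⟩_{A_a B_a}` of non-optimal PBT. The first word indexes
the systems `A = A_1 … A_N`, the second one `B = B_1 … B_N`. -/
def resource (N d : ℕ) : (Fin N → Fin d) × (Fin N → Fin d) → ℂ :=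
  fun p => ∏ a, maxEntangled d (p.1 a, p.2 a)

/-- Alice's operation `O_A = √(d^N) ∑_μ (v_μ / √(d_μ m_μ)) P_μ`. -/
def aliceOp {N d : ℕ} (v : Frame N d → ℝ) : Matrix (Fin N → Fin d) (Fin N → Fin d) ℂ :=
  ((√((d : ℝ) ^ N) : ℝ) : ℂ) •
    ∑ μ : Frame N d,
      ((v μ / √((dimIrrep μ.1 : ℝ) * (multIrrep d μ.1 : ℝ)) : ℝ) : ℂ) • youngProj d μ.1

/-- The resource state `|Φ⟩ = (O_A ⊗ 1_B)|Φ⁺⟩` of optimal PBT. -/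
def optimalResource {N d : ℕ} (v : Frame N d → ℝ) :
    (Fin N → Fin d) × (Fin N → Fin d) → ℂ :=
  (aliceOp v ⊗ₖ (1 : Matrix (Fin N → Fin d) (Fin N → Fin d) ℂ)).mulVec (resource N d)

/-- The fidelity `|⟨φ|ψ⟩|` of two pure states. -/
def fidelity {ι : Type*} [Fintype ι] (φ ψ : ι → ℂ) : ℝ := ‖star φ ⬝ᵥ ψ‖

/-! ### The qubit coefficients -/

/-- The explicit qubit eigenvector, before normalisation. -/
def rawCoeff (N l : ℕ) : ℝ :=
  if Even N then
    (-1) ^ (N / 2 - l) *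
      (Real.sin ((((N : ℝ) + 2) / 2 - l) * N * Real.pi / (N + 2)) -
        Real.sin (((N : ℝ) / 2 - l) * N * Real.pi / (N + 2))) /
      Real.sin (N * Real.pi / (N + 2))
  else
    (-1) ^ ((N - 1) / 2 - l) *
      Real.sin ((((N : ℝ) + 1) / 2 - l) * N * Real.pi / (N + 2)) /
      Real.sin (N * Real.pi / (N + 2))

/-- The normalised coefficient `v_l^{(N)}`. -/
def qubitCoeff (N l : ℕ) : ℝ :=
  rawCoeff N l / √(∑ k ∈ Finset.range (N / 2 + 1), rawCoeff N k ^ 2)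

end PBT

end

/-!
The overlap of the two resource states is the normalised trace of `O_A`, and the Young projectors
have trace `d_μ m_μ`; this gives the formula for the fidelity.

The teleportation matrix is `B Bᵀ`, where `B` records which frames are obtained by removing a box.
For qubits `B` connects neighbouring vertices of a path, so a sine vector is a positive eigenvector,
and by Perron-Frobenius every nonnegative eigenvector is proportional to it.

The restriction of tabloids to two letters embeds the Specht module of `(N - l, l)` into
`(ℂ²)^{⊗N}`. Its image is spanned by products of `l` singlets and lies in the space of
highest-weight vectors; by the branching rule the dimension of the span is at least, and that of the
highest-weight space at most, a ballot number. An equivariant map from the Specht module into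
`(ℂ²)^{⊗N}` is determined by its value at one polytabloid, and the symmetries of the polytabloid
leave `N - 2l + 1` free values.
-/

noncomputable section

namespace PBT

/-! ### The fidelity as a trace -/

instance finiteDimensional_specht {N : ℕ} (μ : N.Partition) :
    FiniteDimensional ℂ (specht μ).toSubmodule :=
  FiniteDimensional.span_of_finite ℂ (Set.finite_range _)

theorem trace_youngProj {N : ℕ} (d : ℕ) (μ : N.Partition) :
    (youngProj d μ).trace = (dimIrrep μ : ℂ) * (multIrrep d μ : ℂ) := by
  have hcard : Nat.card (Equiv.Perm (Fin N)) = N.factorial := by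
    rw [Nat.card_eq_fintype_card, Fintype.card_perm, Fintype.card_fin]
  have hne : (Nat.card (Equiv.Perm (Fin N)) : ℂ) ≠ 0 := by
    rw [hcard]; exact_mod_cast N.factorial_ne_zero
  let := invertibleOfNonzero hne
  have h_orthogonality := Representation.card_inv_mul_sum_char_mul_char_eq_finrank
    (specht μ).toRepresentation (permRep N (Fin d))
  have h_character (σ : Equiv.Perm (Fin N)) :
      (LinearMap.toMatrix' (permRep N (Fin d) σ)).trace = (permRep N (Fin d)).character σ :=
    (LinearMap.trace_eq_matrix_trace ℂ (Pi.basisFun ℂ _) _).symm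
  rw [multIrrep, ← h_orthogonality, hcard, youngProj, Matrix.trace_smul, Matrix.trace_sum,
    smul_eq_mul, div_eq_mul_inv, mul_assoc]
  simp only [Matrix.trace_smul, h_character, smul_eq_mul, mul_comm]

theorem trace_aliceOp {N d : ℕ} (v : Frame N d → ℝ) :
    (aliceOp v).trace = ((√((d : ℝ) ^ N) *
      ∑ μ : Frame N d, v μ * √((dimIrrep μ.1 : ℝ) * (multIrrep d μ.1 : ℝ)) : ℝ) : ℂ) := by
  rw [aliceOp, Matrix.trace_smul, Matrix.trace_sum, smul_eq_mul, Complex.ofReal_mul,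
    Complex.ofReal_sum]
  congr 1
  refine Finset.sum_congr rfl fun μ _ => ?_
  rw [Matrix.trace_smul, trace_youngProj, smul_eq_mul, ← Complex.ofReal_natCast,
    ← Complex.ofReal_natCast, ← Complex.ofReal_mul, ← Complex.ofReal_mul, div_mul_eq_mul_div,
    mul_div_assoc, Real.div_sqrt]

theorem resource_eq_smul_vec_one (N d : ℕ) :
    resource N d = ((√((d : ℝ) ^ N) : ℝ) : ℂ)⁻¹ •
      Matrix.vec (1 : Matrix (Fin N → Fin d) (Fin N → Fin d) ℂ) := by
  have hpow : √((d : ℝ) ^ N) = √(d : ℝ) ^ N := by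
    rw [Real.sqrt_eq_iff_mul_self_eq (by positivity) (by positivity), ← mul_pow,
      Real.mul_self_sqrt (by positivity)]
  ext ⟨w, u⟩
  rw [resource, Pi.smul_apply, Matrix.vec, smul_eq_mul, Matrix.one_apply]
  split_ifs with h
  · obtain rfl : u = w := h
    simp [maxEntangled, hpow]
  · obtain ⟨a, ha⟩ := Function.ne_iff.1 h
    rw [mul_zero]
    exact Finset.prod_eq_zero (Finset.mem_univ a) (if_neg ha.symm)

theorem star_vec_one_dotProduct_kronecker_mulVec {n R : Type*} [Fintype n] [DecidableEq n]
    [CommSemiring R] [StarRing R] (A : Matrix n n R) :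
    star (Matrix.vec (1 : Matrix n n R)) ⬝ᵥ
      (A ⊗ₖ (1 : Matrix n n R)).mulVec (Matrix.vec (1 : Matrix n n R)) = A.trace := by
  rw [Matrix.kronecker_mulVec_vec, Matrix.star_vec_dotProduct_vec, Matrix.conjTranspose_one,
    Matrix.one_mul, Matrix.one_mul, Matrix.one_mul, Matrix.trace_transpose]

theorem star_resource_dotProduct_kronecker_mulVec (N d : ℕ)
    (A : Matrix (Fin N → Fin d) (Fin N → Fin d) ℂ) :
    star (resource N d) ⬝ᵥ
      (A ⊗ₖ (1 : Matrix (Fin N → Fin d) (Fin N → Fin d) ℂ)).mulVec (resource N d) =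
      (((d : ℝ) ^ N : ℝ) : ℂ)⁻¹ * A.trace := by
  rw [resource_eq_smul_vec_one, Matrix.mulVec_smul, star_smul, smul_dotProduct, dotProduct_smul,
    star_vec_one_dotProduct_kronecker_mulVec,
    smul_smul, smul_eq_mul, star_inv₀, Complex.star_def, Complex.conj_ofReal, ← mul_inv,
    ← Complex.ofReal_mul, Real.mul_self_sqrt (by positivity)]

theorem fidelity_resource_optimalResource {N d : ℕ} (v : Frame N d → ℝ) :
    fidelity (resource N d) (optimalResource v) =
      1 / √((d : ℝ) ^ N) *
        |∑ μ : Frame N d, v μ * √((dimIrrep μ.1 : ℝ) * (multIrrep d μ.1 : ℝ))| := by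
  rw [fidelity, optimalResource, star_resource_dotProduct_kronecker_mulVec, trace_aliceOp,
    ← Complex.ofReal_inv, ← Complex.ofReal_mul, Complex.norm_real, Real.norm_eq_abs, ← mul_assoc,
    inv_mul_eq_div, Real.sqrt_div_self', abs_mul, abs_of_nonneg (by positivity)]

theorem fidelity_resource_optimalResource_of_nonneg {N d : ℕ} {v : Frame N d → ℝ}
    (hv : ∀ μ, 0 ≤ v μ) :
    fidelity (resource N d) (optimalResource v) =
      1 / √((d : ℝ) ^ N) *
        ∑ μ : Frame N d, v μ * √((dimIrrep μ.1 : ℝ) * (multIrrep d μ.1 : ℝ)) := by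
  rw [fidelity_resource_optimalResource, abs_of_nonneg]
  exact Finset.sum_nonneg fun μ _ => mul_nonneg (hv μ) (Real.sqrt_nonneg _)

/-! ### Branching of Young frames -/

theorem mem_diagram_zero_right {n : ℕ} (α : n.Partition) (i : ℕ) :
    (i, 0) ∈ diagram α ↔ i < α.parts.card := by
  simp only [diagram, YoungDiagram.mem_ofRowLens, Multiset.length_sort]
  exact ⟨fun ⟨h, _⟩ => h, fun h => ⟨h, α.parts_pos ((Multiset.mem_sort _).1 (List.getElem_mem _))⟩⟩

theorem card_parts_le_of_diagram_le {n m : ℕ} {α : n.Partition} {μ : m.Partition}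
    (h : diagram α ≤ diagram μ) : α.parts.card ≤ μ.parts.card := by
  by_contra! hlt
  exact lt_irrefl _ ((mem_diagram_zero_right μ _).1 (h ((mem_diagram_zero_right α _).2 hlt)))

/-- The branching rule from `S(N)` to `S(N - 1)` as an incidence matrix: whether the second frame
arises from the first one by removing a box. -/
def branching (N d : ℕ) : Matrix (Frame N d) (Frame (N - 1) d) ℝ :=
  open Classical in fun μ α => if diagram α.1 ≤ diagram μ.1 then 1 else 0

theorem teleportationMatrix_eq_branching_mul_transpose (N d : ℕ) :
    teleportationMatrix N d = branching N d * (branching N d).transpose := by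
  classical
  ext μ ν
  have h_height (α : (N - 1).Partition) (h : diagram α ≤ diagram μ.1) : α.parts.card ≤ d :=
    (card_parts_le_of_diagram_le h).trans μ.2
  have h_frames : Nat.card {α : (N - 1).Partition //
      diagram α ≤ diagram μ.1 ∧ diagram α ≤ diagram ν.1} =
      Nat.card {α : Frame (N - 1) d // diagram α.1 ≤ diagram μ.1 ∧ diagram α.1 ≤ diagram ν.1} :=
    Nat.card_congr (Equiv.subtypeSubtypeEquivSubtype fun h => h_height _ h.1).symm
  rw [teleportationMatrix, h_frames, Nat.card_eq_fintype_card, Fintype.card_subtype]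
  simp [branching, Matrix.mul_apply, ← ite_and, and_comm]

theorem isSymm_teleportationMatrix (N d : ℕ) : (teleportationMatrix N d).IsSymm := by
  ext μ ν
  simp only [Matrix.transpose_apply, teleportationMatrix, and_comm]

theorem teleportationMatrix_nonneg {N d : ℕ} (μ ν : Frame N d) : 0 ≤ teleportationMatrix N d μ ν :=
  Nat.cast_nonneg _

theorem teleportationMatrix_ne_zero {N d : ℕ} {μ ν : Frame N d} (α : (N - 1).Partition)
    (hμ : diagram α ≤ diagram μ.1) (hν : diagram α ≤ diagram ν.1) :
    teleportationMatrix N d μ ν ≠ 0 := by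
  have : Nonempty {α : (N - 1).Partition // diagram α ≤ diagram μ.1 ∧ diagram α ≤ diagram ν.1} :=
    ⟨α, hμ, hν⟩
  exact Nat.cast_ne_zero.2 Nat.card_pos.ne'

/-! ### Two-row frames -/

theorem sort_parts_twoRow (n l : ℕ) (hl : 2 * l ≤ n) :
    (twoRow n l hl).1.parts.sort (· ≥ ·) = [n - l, l].filter (· ≠ 0) := by
  refine List.Perm.eq_of_pairwise' (r := (· ≥ ·)) (Multiset.pairwise_sort _ _) ?_ ?_
  · refine List.Pairwise.filter _ (List.pairwise_pair.2 ?_)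
    omega
  · rw [← Multiset.coe_eq_coe, Multiset.sort_eq]
    rfl

theorem mem_diagram_twoRow {n l : ℕ} {hl : 2 * l ≤ n} {c : ℕ × ℕ} :
    c ∈ diagram (twoRow n l hl).1 ↔ c.1 = 0 ∧ c.2 < n - l ∨ c.1 = 1 ∧ c.2 < l := by
  obtain ⟨i, j⟩ := c
  simp only [diagram, YoungDiagram.mem_ofRowLens, sort_parts_twoRow]
  rcases Nat.eq_zero_or_pos l with rfl | h0
  · rcases Nat.eq_zero_or_pos n with rfl | hn
    · simp
    · simp [hn.ne']
  · have h1 : n - l ≠ 0 := by omega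
    rcases i with _ | _ | i <;> simp [h0.ne', h1]

theorem exists_eq_twoRow {n : ℕ} (α : n.Partition) (hα : α.parts.card ≤ 2) :
    ∃ (l : ℕ) (hl : 2 * l ≤ n), α = (twoRow n l hl).1 := by
  have h_pos {i : ℕ} : i ∈ α.parts → 0 < i := α.parts_pos
  have h_sum := α.parts_sum
  suffices ∃ l, 2 * l ≤ n ∧ α.parts = ({n - l, l} : Multiset ℕ).filter (· ≠ 0) by
    obtain ⟨l, hl, h⟩ := this
    exact ⟨l, hl, Nat.Partition.ext h⟩
  interval_cases h : α.parts.card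
  · rw [Multiset.card_eq_zero] at h
    rw [h, Multiset.sum_zero] at h_sum
    subst h_sum
    exact ⟨0, le_rfl, h⟩
  · obtain ⟨a, ha⟩ := Multiset.card_eq_one.1 h
    have ha0 : a ≠ 0 := (h_pos (by simp [ha])).ne'
    rw [ha, Multiset.sum_singleton] at h_sum
    subst h_sum
    exact ⟨0, by simp, by simp [ha, ha0, Multiset.filter_singleton]⟩
  · obtain ⟨a, b, hab⟩ := Multiset.card_eq_two.1 h
    wlog hle : b ≤ a generalizing a b
    · exact this b a (hab.trans (Multiset.pair_comm a b)) (le_of_not_ge hle)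
    have ha0 : a ≠ 0 := (h_pos (by simp [hab])).ne'
    have hb0 : b ≠ 0 := (h_pos (by simp [hab])).ne'
    rw [hab, Multiset.insert_eq_cons, Multiset.sum_cons, Multiset.sum_singleton] at h_sum
    subst h_sum
    exact ⟨b, by omega, by simp [hab, ha0, hb0, Multiset.filter_singleton]⟩

/-- The length of the second row of a frame of height at most two. -/
def secondRow {N : ℕ} (μ : Frame N 2) : ℕ := (diagram μ.1).rowLen 1

@[simp]
theorem secondRow_twoRow {N l : ℕ} (hl : 2 * l ≤ N) : secondRow (twoRow N l hl) = l :=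
  eq_of_forall_lt_iff fun j => by
    rw [secondRow, ← YoungDiagram.mem_iff_lt_rowLen, mem_diagram_twoRow]
    simp

/-- Frames with at most two rows are labelled by the length of the second row. -/
def twoRowEquiv (N : ℕ) : Fin (N / 2 + 1) ≃ Frame N 2 :=
  Equiv.ofBijective (fun l => twoRow N l (by omega))
    ⟨fun _ _ h => Fin.ext (by simpa using congrArg secondRow h), fun μ => by
      obtain ⟨l, hl, h⟩ := exists_eq_twoRow μ.1 μ.2
      exact ⟨⟨l, by omega⟩, Subtype.ext h.symm⟩⟩

theorem forall_frame_two {N : ℕ} {p : Frame N 2 → Prop} :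
    (∀ μ, p μ) ↔ ∀ l hl, p (twoRow N l hl) := by
  refine ⟨fun h l hl => h _, fun h μ => ?_⟩
  obtain ⟨l, rfl⟩ := (twoRowEquiv N).surjective μ
  exact h l (by omega)

theorem sum_frame_eq_sum_range {R : Type*} [AddCommMonoid R] {N : ℕ} {f : Frame N 2 → R}
    {g : ℕ → R} (h : ∀ l hl, f (twoRow N l hl) = g l) :
    ∑ μ, f μ = ∑ l ∈ Finset.range (N / 2 + 1), g l := by
  rw [← Fin.sum_univ_eq_sum_range g, ← (twoRowEquiv N).sum_comp]
  exact Finset.sum_congr rfl fun l _ => h l (by omega)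

theorem diagram_twoRow_le_iff {N l k : ℕ} (hN : 1 ≤ N) {hl : 2 * l ≤ N} {hk : 2 * k ≤ N - 1} :
    diagram (twoRow (N - 1) k hk).1 ≤ diagram (twoRow N l hl).1 ↔ l = k ∨ l = k + 1 := by
  simp only [← YoungDiagram.cells_subset_iff, Finset.subset_iff, YoungDiagram.mem_cells,
    mem_diagram_twoRow]
  constructor
  · intro h
    have h_first : N - 1 - k ≤ N - l := by
      by_contra! hlt
      simpa using h (x := (0, N - l)) (.inl ⟨rfl, hlt⟩)
    have h_second : k ≤ l := by
      by_contra! hlt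
      simpa using h (x := (1, l)) (.inr ⟨rfl, hlt⟩)
    omega
  · intro h c hc
    omega

theorem branching_twoRow {N l k : ℕ} (hN : 1 ≤ N) (hl : 2 * l ≤ N) (hk : 2 * k ≤ N - 1) :
    branching N 2 (twoRow N l hl) (twoRow (N - 1) k hk) = if l = k ∨ l = k + 1 then 1 else 0 := by
  classical
  exact if_congr (diagram_twoRow_le_iff hN) rfl rfl

theorem branching_mulVec_twoRow {N l : ℕ} (hN : 1 ≤ N) (hl : 2 * l ≤ N) (f : ℕ → ℝ) :
    (branching N 2).mulVec (fun α => f (secondRow α)) (twoRow N l hl) =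
      (if 2 * l < N then f l else 0) + if l = 0 then 0 else f (l - 1) := by
  have h_split (k : ℕ) : (if l = k ∨ l = k + 1 then 1 else 0) * f k =
      (if k = l then f k else 0) + if l = 0 then 0 else if k = l - 1 then f k else 0 := by
    split_ifs <;> first | omega | simp
  rw [Matrix.mulVec, dotProduct, sum_frame_eq_sum_range fun k hk => by
    rw [branching_twoRow hN, secondRow_twoRow, h_split], Finset.sum_add_distrib, Finset.sum_ite_eq']
  congr 1
  · exact if_congr (by rw [Finset.mem_range]; omega) rfl rfl
  · rcases l with _ | l
    · simp
    · simp only [Nat.add_eq_zero_iff, one_ne_zero, and_false, if_false, Finset.sum_ite_eq']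
      exact if_pos (Finset.mem_range.2 (by omega))

theorem branching_transpose_mulVec_twoRow {N k : ℕ} (hN : 1 ≤ N) (hk : 2 * k ≤ N - 1)
    (f : ℕ → ℝ) :
    (branching N 2).transpose.mulVec (fun μ => f (secondRow μ)) (twoRow (N - 1) k hk) =
      f k + if 2 * (k + 1) ≤ N then f (k + 1) else 0 := by
  have h_split (l : ℕ) : (if l = k ∨ l = k + 1 then 1 else 0) * f l =
      (if l = k then f l else 0) + if l = k + 1 then f l else 0 := by
    split_ifs <;> first | omega | simp
  rw [Matrix.mulVec, dotProduct, sum_frame_eq_sum_range fun l hl => by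
    rw [Matrix.transpose_apply, branching_twoRow hN, secondRow_twoRow, h_split],
    Finset.sum_add_distrib, Finset.sum_ite_eq', Finset.sum_ite_eq']
  congr 1
  · exact if_pos (Finset.mem_range.2 (by omega))
  · exact if_congr (by rw [Finset.mem_range]; omega) rfl rfl

theorem reflTransGen_teleportationMatrix_two {N : ℕ} (μ : Frame N 2) :
    Relation.ReflTransGen (fun μ ν => teleportationMatrix N 2 μ ν ≠ 0)
      (twoRow N 0 (Nat.zero_le N)) μ := by
  revert μ
  refine forall_frame_two.2 fun l hl => ?_
  induction l with
  | zero => rfl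
  | succ l ih =>
    exact (ih (by omega)).tail (teleportationMatrix_ne_zero (twoRow (N - 1) l (by omega)).1
      ((diagram_twoRow_le_iff (by omega)).2 (.inl rfl))
      ((diagram_twoRow_le_iff (by omega)).2 (.inr rfl)))

/-! ### Positive eigenvectors of symmetric matrices -/

section PerronFrobenius

variable {ι : Type*} [Fintype ι] {M : Matrix ι ι ℝ} {a x v : ι → ℝ} {α β : ℝ}

theorem eigenvalue_eq_of_dotProduct_ne_zero (hM : M.IsSymm) (ha : M.mulVec a = α • a)
    (hx : M.mulVec x = β • x) (hax : a ⬝ᵥ x ≠ 0) : α = β := by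
  have h : α * (a ⬝ᵥ x) = β * (a ⬝ᵥ x) := by
    calc α * (a ⬝ᵥ x) = M.mulVec a ⬝ᵥ x := by rw [ha, smul_dotProduct, smul_eq_mul]
      _ = a ⬝ᵥ M.mulVec x := by
        rw [Matrix.dotProduct_mulVec, ← Matrix.mulVec_transpose, hM.eq]
      _ = β * (a ⬝ᵥ x) := by rw [hx, dotProduct_smul, smul_eq_mul]
  exact mul_right_cancel₀ hax h

/-- The ground-state representation of the quadratic form of `α - M`. -/
theorem sum_mul_sq_sub_div_eq (hM : M.IsSymm) (ha0 : ∀ i, a i ≠ 0) (ha : M.mulVec a = α • a) :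
    ∑ i, ∑ j, M i j * (a i * a j) * (x i / a i - x j / a j) ^ 2 =
      2 * (α * (x ⬝ᵥ x) - x ⬝ᵥ M.mulVec x) := by
  have h_diag : ∑ i, ∑ j, x i ^ 2 / a i * (M i j * a j) = α * (x ⬝ᵥ x) := by
    rw [dotProduct, Finset.mul_sum]
    refine Finset.sum_congr rfl fun i _ => ?_
    have h_row : ∑ j, M i j * a j = α * a i := congrFun ha i
    rw [← Finset.mul_sum, h_row]
    field_simp [ha0 i]
  have h_diag' : ∑ i, ∑ j, x j ^ 2 / a j * (M i j * a i) = α * (x ⬝ᵥ x) := by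
    refine Finset.sum_comm.trans (Eq.trans ?_ h_diag)
    simp only [hM.apply]
  have h_cross : ∑ i, ∑ j, 2 * (x i * (M i j * x j)) = 2 * (x ⬝ᵥ M.mulVec x) := by
    simp only [Finset.mul_sum, dotProduct, Matrix.mulVec]
  calc ∑ i, ∑ j, M i j * (a i * a j) * (x i / a i - x j / a j) ^ 2
      = ∑ i, ∑ j, (x i ^ 2 / a i * (M i j * a j) + x j ^ 2 / a j * (M i j * a i) -
          2 * (x i * (M i j * x j))) := by
        refine Finset.sum_congr rfl fun i _ => Finset.sum_congr rfl fun j _ => ?_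
        field_simp [ha0 i, ha0 j]
        ring
    _ = 2 * (α * (x ⬝ᵥ x) - x ⬝ᵥ M.mulVec x) := by
        simp only [Finset.sum_sub_distrib, Finset.sum_add_distrib, h_diag, h_diag', h_cross]
        ring

theorem div_eq_div_of_ne_zero (hM : M.IsSymm) (hM0 : ∀ i j, 0 ≤ M i j) (ha0 : ∀ i, 0 < a i)
    (ha : M.mulVec a = α • a) (hx : M.mulVec x = α • x) {i j : ι} (hij : M i j ≠ 0) :
    x i / a i = x j / a j := by
  have h_nonneg (i j : ι) : 0 ≤ M i j * (a i * a j) * (x i / a i - x j / a j) ^ 2 :=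
    mul_nonneg (mul_nonneg (hM0 i j) (mul_pos (ha0 i) (ha0 j)).le) (sq_nonneg _)
  have h_sum : ∑ i, ∑ j, M i j * (a i * a j) * (x i / a i - x j / a j) ^ 2 = 0 := by
    rw [sum_mul_sq_sub_div_eq hM (fun i => (ha0 i).ne') ha, hx, dotProduct_smul, smul_eq_mul,
      sub_self, mul_zero]
  have h_row := (Finset.sum_eq_zero_iff_of_nonneg fun i _ =>
    Finset.sum_nonneg fun j _ => h_nonneg i j).1 h_sum i (Finset.mem_univ i)
  have h_entry := (Finset.sum_eq_zero_iff_of_nonneg fun j _ => h_nonneg i j).1 h_row j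
    (Finset.mem_univ j)
  have h_sq := (mul_eq_zero.1 h_entry).resolve_left
    (mul_ne_zero hij (mul_pos (ha0 i) (ha0 j)).ne')
  exact sub_eq_zero.1 (pow_eq_zero_iff two_ne_zero |>.1 h_sq)

theorem eq_div_sqrt_sum_sq_of_eigenvector (hM : M.IsSymm) (hM0 : ∀ i j, 0 ≤ M i j)
    {i₀ : ι} (h_conn : ∀ i, Relation.ReflTransGen (fun i j => M i j ≠ 0) i₀ i)
    (ha0 : ∀ i, 0 < a i) (ha : M.mulVec a = α • a) (hv0 : ∀ i, 0 ≤ v i)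
    (hv1 : ∑ i, v i ^ 2 = 1) (hv : M.mulVec v = β • v) (i : ι) :
    v i = a i / √(∑ j, a j ^ 2) := by
  have h_ne : a ⬝ᵥ v ≠ 0 := fun h => by
    have h_term := (Finset.sum_eq_zero_iff_of_nonneg fun i _ => mul_nonneg (ha0 i).le (hv0 i)).1 h
    have h_zero (i : ι) : v i = 0 :=
      (mul_eq_zero.1 (h_term i (Finset.mem_univ i))).resolve_left (ha0 i).ne'
    simp [h_zero] at hv1
  obtain rfl := eigenvalue_eq_of_dotProduct_ne_zero hM ha hv h_ne
  have h_const (i : ι) : v i / a i = v i₀ / a i₀ := by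
    induction h_conn i with
    | refl => rfl
    | tail _ hij ih => rw [← ih, div_eq_div_of_ne_zero hM hM0 ha0 ha hv hij]
  obtain ⟨c, hc⟩ : ∃ c, c = v i₀ / a i₀ := ⟨_, rfl⟩
  have hc0 : 0 ≤ c := hc ▸ div_nonneg (hv0 i₀) (ha0 i₀).le
  have h_eq (i : ι) : v i = c * a i := (div_eq_iff (ha0 i).ne').1 ((h_const i).trans hc.symm)
  have h_norm : c * √(∑ j, a j ^ 2) = 1 := by
    rw [← Real.sqrt_sq hc0, ← Real.sqrt_mul (sq_nonneg _),
      Real.sqrt_eq_one, ← hv1, Finset.mul_sum]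
    simp only [h_eq, mul_pow]
  rw [h_eq, eq_div_iff (right_ne_zero_of_mul_eq_one h_norm), mul_right_comm, h_norm, one_mul]

end PerronFrobenius

/-! ### The qubit eigenvector -/

/-- The entry at `(N - l, l)` of the positive eigenvector of the qubit teleportation matrix, up to
scale. -/
def sineCoeff (N l : ℕ) : ℝ := Real.sin (((N : ℝ) + 1 - 2 * l) * (Real.pi / (N + 2)))

theorem sineCoeff_pos {N l : ℕ} (hl : 2 * l ≤ N) : 0 < sineCoeff N l := by
  have hl' : (2 * l : ℝ) ≤ N := by exact_mod_cast hl
  refine Real.sin_pos_of_pos_of_lt_pi (mul_pos (by linarith) (by positivity)) ?_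
  rw [← mul_div_assoc, div_lt_iff₀ (by positivity), mul_comm Real.pi]
  exact mul_lt_mul_of_pos_right (by linarith [l.cast_nonneg (α := ℝ)]) Real.pi_pos

theorem sin_sub_add_sin_add (y x : ℝ) :
    Real.sin (y - x) + Real.sin (y + x) = 2 * Real.cos x * Real.sin y := by
  rw [Real.sin_sub, Real.sin_add]
  ring

theorem branching_transpose_mulVec_sineCoeff {N : ℕ} (hN : 1 ≤ N) :
    (branching N 2).transpose.mulVec (fun μ => sineCoeff N (secondRow μ)) =
      (2 * Real.cos (Real.pi / (N + 2))) •
        fun α => Real.sin (((N : ℝ) - 2 * secondRow α) * (Real.pi / (N + 2))) := by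
  refine funext (forall_frame_two.2 fun k hk => ?_)
  have h_end : (if 2 * (k + 1) ≤ N then sineCoeff N (k + 1) else 0) = sineCoeff N (k + 1) := by
    refine ite_eq_left_iff.2 fun h => ?_
    have hk' : (N : ℝ) + 1 = 2 * (k + 1 : ℕ) := by exact_mod_cast (by omega : N + 1 = 2 * (k + 1))
    rw [sineCoeff, hk', sub_self, zero_mul, Real.sin_zero]
  rw [branching_transpose_mulVec_twoRow hN hk, h_end, Pi.smul_apply, smul_eq_mul, secondRow_twoRow,
    ← sin_sub_add_sin_add, sineCoeff, sineCoeff, add_comm]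
  push_cast
  ring_nf

theorem branching_mulVec_sin {N : ℕ} (hN : 1 ≤ N) :
    (branching N 2).mulVec
        (fun α => Real.sin (((N : ℝ) - 2 * secondRow α) * (Real.pi / (N + 2)))) =
      (2 * Real.cos (Real.pi / (N + 2))) • fun μ => sineCoeff N (secondRow μ) := by
  refine funext (forall_frame_two.2 fun l hl => ?_)
  let b (k : ℕ) : ℝ := Real.sin (((N : ℝ) - 2 * k) * (Real.pi / (N + 2)))
  have h_same : (if 2 * l < N then b l else 0) = b l := by
    refine ite_eq_left_iff.2 fun h => ?_
    have hl' : (N : ℝ) = 2 * l := by exact_mod_cast (by omega : N = 2 * l)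
    simp only [b, hl', sub_self, zero_mul, Real.sin_zero]
  have h_below : (if l = 0 then 0 else b (l - 1)) =
      Real.sin (((N : ℝ) - 2 * l + 2) * (Real.pi / (N + 2))) := by
    rcases l with _ | l
    · have h_pi : ((N : ℝ) + 2) * (Real.pi / (N + 2)) = Real.pi := by field_simp
      simp [h_pi]
    · simp only [Nat.add_eq_zero_iff, one_ne_zero, and_false, if_false, Nat.add_sub_cancel, b]
      push_cast
      ring_nf
  rw [branching_mulVec_twoRow hN hl b, h_same, h_below, Pi.smul_apply, smul_eq_mul,
    secondRow_twoRow, sineCoeff, ← sin_sub_add_sin_add]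
  simp only [b]
  ring_nf

theorem teleportationMatrix_mulVec_sineCoeff {N : ℕ} (hN : 1 ≤ N) :
    (teleportationMatrix N 2).mulVec (fun μ => sineCoeff N (secondRow μ)) =
      (2 * Real.cos (Real.pi / (N + 2))) ^ 2 • fun μ => sineCoeff N (secondRow μ) := by
  rw [teleportationMatrix_eq_branching_mul_transpose, ← Matrix.mulVec_mulVec,
    branching_transpose_mulVec_sineCoeff hN, Matrix.mulVec_smul, branching_mulVec_sin hN, smul_smul,
    sq]

theorem eigenvector_eq_sineCoeff_div {N : ℕ} (hN : 1 ≤ N) {v : Frame N 2 → ℝ} {lam : ℝ}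
    (hv0 : ∀ μ, 0 ≤ v μ) (hv1 : ∑ μ, v μ ^ 2 = 1)
    (hv : Module.End.HasEigenvector (Matrix.toLin' (teleportationMatrix N 2)) lam v) (l : ℕ)
    (hl : 2 * l ≤ N) :
    v (twoRow N l hl) =
      sineCoeff N l / √(∑ k ∈ Finset.range (N / 2 + 1), sineCoeff N k ^ 2) := by
  have h_pos : ∀ μ : Frame N 2, 0 < sineCoeff N (secondRow μ) :=
    forall_frame_two.2 fun k hk => by
      rw [secondRow_twoRow]
      exact sineCoeff_pos hk
  have h_sum : ∑ μ : Frame N 2, sineCoeff N (secondRow μ) ^ 2 =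
      ∑ k ∈ Finset.range (N / 2 + 1), sineCoeff N k ^ 2 :=
    sum_frame_eq_sum_range fun k hk => by rw [secondRow_twoRow]
  rw [eq_div_sqrt_sum_sq_of_eigenvector (isSymm_teleportationMatrix N 2) teleportationMatrix_nonneg
    reflTransGen_teleportationMatrix_two h_pos (teleportationMatrix_mulVec_sineCoeff hN) hv0 hv1
    hv.apply_eq_smul, secondRow_twoRow, h_sum]

/-! ### The explicit qubit coefficients -/

theorem sin_nat_mul_pi_sub_two_mul (m : ℕ) (x : ℝ) :
    Real.sin (m * (Real.pi - 2 * x)) = -((-1) ^ m * Real.sin (2 * m * x)) := by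
  rw [mul_sub, Real.sin_nat_mul_pi_sub]
  ring_nf

theorem mul_nat_mul_pi_div (N : ℕ) (y : ℝ) :
    y * N * Real.pi / (N + 2) = y * (Real.pi - 2 * (Real.pi / (N + 2))) := by
  field_simp
  ring

theorem sin_nat_mul_pi_div (N : ℕ) :
    Real.sin (N * Real.pi / (N + 2)) = Real.sin (2 * (Real.pi / (N + 2))) := by
  have h := mul_nat_mul_pi_div N 1
  rw [one_mul, one_mul] at h
  rw [h, Real.sin_pi_sub]

theorem neg_one_pow_mul_self {R : Type*} [CommRing R] (m : ℕ) :
    ((-1 : R) ^ m) * (-1) ^ m = 1 := by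
  rw [← mul_pow, neg_one_mul, neg_neg, one_pow]

section Angle

variable {N : ℕ}

theorem sin_pi_div_pos : 0 < Real.sin (Real.pi / (N + 2)) :=
  Real.sin_pos_of_pos_of_lt_pi (by positivity)
    (div_lt_self Real.pi_pos (by linarith [N.cast_nonneg (α := ℝ)]))

theorem cos_pi_div_pos (hN : 1 ≤ N) : 0 < Real.cos (Real.pi / (N + 2)) := by
  have hN' : (1 : ℝ) ≤ N := by exact_mod_cast hN
  have h_pos : 0 < Real.pi / ((N : ℝ) + 2) := by positivity
  exact Real.cos_pos_of_mem_Ioo ⟨by linarith [Real.pi_pos],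
    div_lt_div_of_pos_left Real.pi_pos two_pos (by linarith)⟩

theorem sin_two_mul_pi_div_pos (hN : 1 ≤ N) : 0 < Real.sin (2 * (Real.pi / (N + 2))) := by
  rw [Real.sin_two_mul]
  exact mul_pos (mul_pos two_pos sin_pi_div_pos) (cos_pi_div_pos hN)

end Angle

theorem rawCoeff_of_even {N l : ℕ} (hN : 1 ≤ N) (h_even : Even N) (hl : 2 * l ≤ N) :
    rawCoeff N l = sineCoeff N l / Real.sin (Real.pi / (N + 2)) := by
  obtain ⟨m, hm⟩ : ∃ m, N = 2 * (l + m) := by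
    obtain ⟨M, rfl⟩ := h_even
    exact ⟨M - l, by omega⟩
  have hm' : (N : ℝ) = 2 * (l + m) := by exact_mod_cast hm
  have h_half : (N : ℝ) / 2 - l = m := by rw [hm']; ring
  have h_half' : ((N : ℝ) + 2) / 2 - l = (m + 1 : ℕ) := by rw [hm']; push_cast; ring
  have h_cos := (cos_pi_div_pos hN).ne'
  set x := Real.pi / ((N : ℝ) + 2) with hx
  have h_sum : Real.sin (2 * m * x) + Real.sin (2 * (m + 1 : ℕ) * x) =
      2 * Real.cos x * sineCoeff N l := by
    rw [sineCoeff, ← hx, ← sin_sub_add_sin_add, hm']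
    push_cast
    ring_nf
  calc rawCoeff N l
      = (-1) ^ m * (-1) ^ m * (Real.sin (2 * m * x) + Real.sin (2 * (m + 1 : ℕ) * x)) /
          (2 * Real.sin x * Real.cos x) := by
        rw [rawCoeff, if_pos h_even, mul_nat_mul_pi_div, mul_nat_mul_pi_div, sin_nat_mul_pi_div,
          h_half, h_half', sin_nat_mul_pi_sub_two_mul, sin_nat_mul_pi_sub_two_mul, ← hx,
          Nat.div_eq_of_eq_mul_right two_pos hm, Nat.add_sub_cancel_left, Real.sin_two_mul]
        ring
    _ = sineCoeff N l / Real.sin x := by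
        rw [neg_one_pow_mul_self, one_mul, h_sum, mul_right_comm 2 (Real.sin x), mul_div_mul_left]
        exact mul_ne_zero two_ne_zero h_cos

theorem rawCoeff_of_odd {N l : ℕ} (h_odd : Odd N) (hl : 2 * l ≤ N) :
    rawCoeff N l = sineCoeff N l / Real.sin (2 * (Real.pi / (N + 2))) := by
  obtain ⟨m, hm⟩ : ∃ m, N = 2 * (l + m) + 1 := by
    obtain ⟨M, rfl⟩ := h_odd
    exact ⟨M - l, by omega⟩
  have hm' : (N : ℝ) = 2 * (l + m) + 1 := by exact_mod_cast hm
  have h_half : ((N : ℝ) + 1) / 2 - l = (m + 1 : ℕ) := by rw [hm']; push_cast; ring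
  have h_index : (N - 1) / 2 - l = m := by omega
  have h_sine : Real.sin (2 * (m + 1 : ℕ) * (Real.pi / (N + 2))) = sineCoeff N l := by
    rw [sineCoeff, hm']
    push_cast
    ring_nf
  rw [rawCoeff, if_neg (Nat.not_even_iff_odd.2 h_odd), mul_nat_mul_pi_div, sin_nat_mul_pi_div,
    h_half, sin_nat_mul_pi_sub_two_mul, h_sine, h_index, pow_succ, mul_neg_one, neg_mul, neg_neg,
    ← mul_assoc, neg_one_pow_mul_self, one_mul]

theorem exists_rawCoeff_eq_div {N : ℕ} (hN : 1 ≤ N) :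
    ∃ c : ℝ, 0 < c ∧ ∀ l, 2 * l ≤ N → rawCoeff N l = sineCoeff N l / c := by
  rcases N.even_or_odd with h | h
  · exact ⟨_, sin_pi_div_pos, fun l hl => rawCoeff_of_even hN h hl⟩
  · exact ⟨_, sin_two_mul_pi_div_pos hN, fun l hl => rawCoeff_of_odd h hl⟩

theorem qubitCoeff_eq_sineCoeff_div {N l : ℕ} (hN : 1 ≤ N) (hl : 2 * l ≤ N) :
    qubitCoeff N l = sineCoeff N l / √(∑ k ∈ Finset.range (N / 2 + 1), sineCoeff N k ^ 2) := by
  obtain ⟨c, hc, h⟩ := exists_rawCoeff_eq_div hN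
  have h_sum : ∑ k ∈ Finset.range (N / 2 + 1), rawCoeff N k ^ 2 =
      (∑ k ∈ Finset.range (N / 2 + 1), sineCoeff N k ^ 2) / c ^ 2 := by
    rw [Finset.sum_div]
    refine Finset.sum_congr rfl fun k hk => ?_
    rw [h k (by rw [Finset.mem_range] at hk; omega), div_pow]
  rw [qubitCoeff, h_sum, h l hl, Real.sqrt_div' _ (sq_nonneg c), Real.sqrt_sq hc.le,
    div_div_div_cancel_right₀ hc.ne']

theorem four_mul_sin_mul_sum_sin_sq (a d : ℝ) (n : ℕ) :
    4 * Real.sin d * ∑ l ∈ Finset.range n, Real.sin (a + l * d) ^ 2 =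
      2 * n * Real.sin d - (Real.sin (2 * a + (2 * n - 1) * d) - Real.sin (2 * a - d)) := by
  induction n with
  | zero => simp; ring_nf
  | succ n ih =>
    have h_telescope : Real.sin (2 * (a + n * d) + d) - Real.sin (2 * (a + n * d) - d) =
        2 * Real.sin d * (1 - 2 * Real.sin (a + n * d) ^ 2) := by
      rw [Real.sin_add, Real.sin_sub, Real.cos_two_mul, Real.cos_sq']
      ring
    rw [Finset.sum_range_succ, mul_add, ih]
    push_cast
    ring_nf at h_telescope ⊢
    linarith

theorem sum_sineCoeff_sq {N : ℕ} (hN : 1 ≤ N) :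
    ∑ l ∈ Finset.range (N / 2 + 1), sineCoeff N l ^ 2 = ((N : ℝ) + 2) / 4 := by
  have h_sin := sin_two_mul_pi_div_pos hN
  set x := Real.pi / ((N : ℝ) + 2) with hx
  have h_pi : ((N : ℝ) + 2) * x = Real.pi := by rw [hx]; field_simp
  have h_two_pi : Real.sin (2 * ((N + 1) * x) - -(2 * x)) = 0 := by
    rw [← Real.sin_two_pi, ← h_pi]
    ring_nf
  have h_arg (l : ℕ) : sineCoeff N l = Real.sin ((N + 1) * x + l * -(2 * x)) := by
    rw [sineCoeff, ← hx]
    ring_nf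
  have h_sum := four_mul_sin_mul_sum_sin_sq (((N : ℝ) + 1) * x) (-(2 * x)) (N / 2 + 1)
  rw [h_two_pi, Real.sin_neg, sub_zero] at h_sum
  simp only [h_arg]
  refine mul_left_cancel₀ h_sin.ne' ?_
  rcases Nat.even_or_odd' N with ⟨M, hM | hM⟩
  · have hM' : (N : ℝ) = 2 * M := by exact_mod_cast hM
    have h_last : Real.sin (2 * ((N + 1) * x) + (2 * (N / 2 + 1 : ℕ) - 1) * -(2 * x)) = 0 := by
      rw [show N / 2 = M by omega, hM', ← Real.sin_zero]
      push_cast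
      ring_nf
    have h_card : ((N / 2 + 1 : ℕ) : ℝ) = (N + 2) / 2 := by
      rw [show N / 2 = M by omega, hM']; push_cast; ring
    rw [h_last, h_card] at h_sum
    linarith
  · have hM' : (N : ℝ) = 2 * M + 1 := by exact_mod_cast hM
    have h_last : Real.sin (2 * ((N + 1) * x) + (2 * (N / 2 + 1 : ℕ) - 1) * -(2 * x)) =
        Real.sin (2 * x) := by
      rw [show N / 2 = M by omega, hM']
      push_cast
      ring_nf
    have h_card : ((N / 2 + 1 : ℕ) : ℝ) = (N + 1) / 2 := by
      rw [show N / 2 = M by omega, hM']; push_cast; ring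
    rw [h_last, h_card] at h_sum
    linarith

/-! ### Ballot numbers -/

/-- The ballot number: the number of standard Young tableaux of shape `(N - l, l)`, defined by the
branching rule. -/
def ballot : ℕ → ℕ → ℕ
  | _, 0 => 1
  | 0, _ + 1 => 0
  | N + 1, l + 1 => if 2 * (l + 1) ≤ N + 1 then ballot N (l + 1) + ballot N l else 0

theorem succ_mul_ballot (N l : ℕ) (hl : 2 * l ≤ N + 1) :
    ((N : ℝ) + 1) * ballot N l = ((N : ℝ) + 1 - 2 * l) * (N + 1).choose l := by
  induction N generalizing l with
  | zero =>
    obtain rfl : l = 0 := by omega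
    simp [ballot]
  | succ N ih =>
    rcases l with _ | l
    · simp [ballot]
    rw [ballot]
    split_ifs with h
    · have hchoose : ((N + 1).choose (l + 1) : ℝ) * (l + 1) = (N + 1).choose l * (N + 1 - l) := by
        have := congrArg (Nat.cast (R := ℝ)) (Nat.choose_succ_right_eq (N + 1) l)
        rw [Nat.cast_mul, Nat.cast_mul, Nat.cast_sub (by omega)] at this
        exact_mod_cast this
      have ih₁ := ih (l + 1) h
      have ih₂ := ih l (by omega)
      have hN : ((N : ℝ) + 1) ≠ 0 := by positivity
      rw [Nat.choose_succ_succ' (N + 1) l]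
      push_cast at ih₁ ih₂ ⊢
      refine mul_left_cancel₀ hN ?_
      linear_combination ((N : ℝ) + 2) * (ih₁ + ih₂) - 2 * hchoose
    · have hl' : (2 * (l + 1) : ℝ) = N + 1 + 1 := by
        exact_mod_cast (by omega : 2 * (l + 1) = N + 1 + 1)
      push_cast
      rw [hl']
      ring

/-! ### Products of singlets -/

@[simp] theorem permRep_apply {N : ℕ} {κ : Type} (σ : Equiv.Perm (Fin N)) (f : (Fin N → κ) → ℂ)
    (w : Fin N → κ) : permRep N κ σ f w = f (w ∘ σ) := rfl

/-- The zeta transform on a poset, which sums a function over all smaller elements. -/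
def zetaTransform (P : Type*) [Preorder P] [LocallyFiniteOrderBot P] : (P → ℂ) →ₗ[ℂ] (P → ℂ) where
  toFun f w := ∑ u ∈ Finset.Iic w, f u
  map_add' _ _ := funext fun _ => Finset.sum_add_distrib
  map_smul' _ _ := funext fun _ => (Finset.mul_sum _ _ _).symm

theorem zetaTransform_apply {P : Type*} [Preorder P] [LocallyFiniteOrderBot P] (f : P → ℂ)
    (w : P) : zetaTransform P f w = ∑ u ∈ Finset.Iic w, f u := rfl

theorem zetaTransform_permRep {N : ℕ} {κ : Type} [DecidableEq κ] [PartialOrder κ]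
    [LocallyFiniteOrderBot κ] (σ : Equiv.Perm (Fin N)) (f : (Fin N → κ) → ℂ) :
    zetaTransform _ (permRep N κ σ f) = permRep N κ σ (zetaTransform _ f) := by
  funext w
  refine Finset.sum_equiv (Equiv.arrowCongr σ.symm (Equiv.refl κ)) (fun u => ?_) fun u _ => rfl
  simp only [Finset.mem_Iic]
  exact (σ.forall_congr_right (q := fun i => u i ≤ w i)).symm

/-- The number of ones in a binary word. -/
def weight {N : ℕ} (w : Fin N → Fin 2) : ℕ := ∑ i, (w i).val

@[simp] theorem weight_cons {N : ℕ} (x : Fin 2) (w : Fin N → Fin 2) :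
    weight (Fin.cons x w : Fin (N + 1) → Fin 2) = x.val + weight w := by
  simp [weight, Fin.sum_univ_succ]

theorem weight_comp_perm {N : ℕ} (w : Fin N → Fin 2) (σ : Equiv.Perm (Fin N)) :
    weight (w ∘ σ) = weight w :=
  Equiv.sum_comp σ fun i => (w i).val

theorem weight_add_card_le {N : ℕ} {w : Fin N → Fin 2} {s : Finset (Fin N)}
    (hs : ∀ i ∈ s, w i = 0) : weight w + s.card ≤ N := by
  have hle : weight w ≤ sᶜ.card := by
    rw [weight, ← Finset.sum_add_sum_compl s, Finset.sum_eq_zero fun i hi => by simp [hs i hi],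
      zero_add, Finset.card_eq_sum_ones]
    exact Finset.sum_le_sum fun i _ => by omega
  have := s.card_add_card_compl
  rw [Fintype.card_fin] at this
  omega

theorem eq_of_le_of_weight_eq {N : ℕ} {u w : Fin N → Fin 2} (hle : u ≤ w)
    (h : weight u = weight w) : u = w :=
  funext fun i => Fin.ext <| (Finset.sum_eq_sum_iff_of_le (f := fun i => (u i).val)
    fun i _ => hle i).1 h i (Finset.mem_univ i)

/-- The value of a letter of a binary word as a complex number. -/
def bit (x : Fin 2) : ℂ := (x.val : ℂ)

@[simp] theorem bit_zero : bit 0 = 0 := by simp [bit]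

@[simp] theorem bit_one : bit 1 = 1 := by simp [bit]

theorem one_sub_bit_ne_zero {x : Fin 2} : 1 - bit x ≠ 0 ↔ x = 0 := by
  fin_cases x <;> simp

theorem bit_sub_bit_ne_zero {x y : Fin 2} : bit x - bit y ≠ 0 ↔ x.val + y.val = 1 := by
  fin_cases x <;> fin_cases y <;> simp

/-- The product of singlets on the pairs of letters given by `s`, with the letter `0` at the
remaining places. -/
def pairFun {N l : ℕ} (s : Fin 2 × Fin l ↪ Fin N) (w : Fin N → Fin 2) : ℂ :=
  (∏ i, (bit (w (s (1, i))) - bit (w (s (0, i))))) *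
    ∏ c ∈ (Finset.univ.map s)ᶜ, (1 - bit (w c))

theorem pairFun_ne_zero_iff {N l : ℕ} {s : Fin 2 × Fin l ↪ Fin N} {w : Fin N → Fin 2} :
    pairFun s w ≠ 0 ↔ (∀ i, (w (s (1, i))).val + (w (s (0, i))).val = 1) ∧
      ∀ c, (∀ p, s p ≠ c) → w c = 0 := by
  simp only [pairFun, mul_ne_zero_iff, Finset.prod_ne_zero_iff, bit_sub_bit_ne_zero,
    one_sub_bit_ne_zero, Finset.mem_univ, true_implies, Finset.mem_compl, Finset.mem_map, true_and,
    not_exists, ne_eq]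

theorem weight_eq_of_pairFun_ne_zero {N l : ℕ} {s : Fin 2 × Fin l ↪ Fin N} {w : Fin N → Fin 2}
    (h : pairFun s w ≠ 0) : weight w = l := by
  obtain ⟨hpair, hrest⟩ := pairFun_ne_zero_iff.1 h
  rw [weight, ← Finset.sum_add_sum_compl (Finset.univ.map s),
    Finset.sum_eq_zero (s := (Finset.univ.map s)ᶜ) fun c hc => by
      rw [hrest c (by simpa using hc), Fin.val_zero],
    Finset.sum_map, Fintype.sum_prod_type_right]
  simp [add_comm (w (s (0, _))).val, hpair]

section PairSwap

variable {N l : ℕ} (s : Fin 2 × Fin l ↪ Fin N) (i : Fin l)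

/-- The transposition of the two places of a pair. -/
def pairSwap : Equiv.Perm (Fin N) := Equiv.swap (s (0, i)) (s (1, i))

@[simp] theorem pairSwap_apply_zero : pairSwap s i (s (0, i)) = s (1, i) :=
  Equiv.swap_apply_left _ _

@[simp] theorem pairSwap_apply_one : pairSwap s i (s (1, i)) = s (0, i) :=
  Equiv.swap_apply_right _ _

theorem pairSwap_apply_of_ne {j : Fin l} (hj : j ≠ i) (r : Fin 2) :
    pairSwap s i (s (r, j)) = s (r, j) :=
  Equiv.swap_apply_of_ne_of_ne (fun h => hj (congrArg Prod.snd (s.injective h)))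
    fun h => hj (congrArg Prod.snd (s.injective h))

theorem comp_pairSwap_eq_self {w : Fin N → Fin 2} (h : w (s (0, i)) = w (s (1, i))) :
    w ∘ pairSwap s i = w := by
  funext j
  rw [Function.comp_apply, pairSwap, Equiv.swap_apply_def]
  split_ifs with h₀ h₁
  · rw [h₀, h]
  · rw [h₁, h]
  · rfl

theorem eq_zero_of_permRep_pairSwap {g : (Fin N → Fin 2) → ℂ}
    (hg : permRep N (Fin 2) (pairSwap s i) g = -g) {w : Fin N → Fin 2}
    (h : w (s (0, i)) = w (s (1, i))) : g w = 0 := by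
  have hw := congrFun hg w
  rw [permRep_apply, comp_pairSwap_eq_self s i h, Pi.neg_apply] at hw
  exact self_eq_neg.1 hw

theorem permRep_pairSwap_pairFun : permRep N (Fin 2) (pairSwap s i) (pairFun s) = -pairFun s := by
  funext w
  rw [permRep_apply, Pi.neg_apply, pairFun, pairFun, ← neg_mul]
  congr 1
  · rw [← Finset.mul_prod_erase _ _ (Finset.mem_univ i),
      ← Finset.mul_prod_erase _ _ (Finset.mem_univ i), ← neg_mul]
    congr 1
    · simp
    · refine Finset.prod_congr rfl fun j hj => ?_
      simp only [Function.comp_apply, pairSwap_apply_of_ne s i (Finset.ne_of_mem_erase hj)]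
  · refine Finset.prod_congr rfl fun c hc => ?_
    have hc' : ∀ p, s p ≠ c := by simpa using hc
    rw [Function.comp_apply, pairSwap, Equiv.swap_apply_of_ne_of_ne (hc' _).symm (hc' _).symm]

end PairSwap

/-- The span of the functions `pairFun`, a model of the Specht module of `(N - l, l)`. -/
def pairSpan (N l : ℕ) : Submodule ℂ ((Fin N → Fin 2) → ℂ) :=
  Submodule.span ℂ (Set.range (pairFun (N := N) (l := l)))

/-- The highest weight functions: the functions on words with `l` ones whose zeta transform
vanishes on the words with fewer than `l` zeros. -/
def highestWeight (N l : ℕ) : Submodule ℂ ((Fin N → Fin 2) → ℂ) where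
  carrier := {f | (∀ w, weight w ≠ l → f w = 0) ∧
    ∀ w, N < l + weight w → zetaTransform _ f w = 0}
  zero_mem' := by simp
  add_mem' := by
    rintro f g ⟨hf, hf'⟩ ⟨hg, hg'⟩
    exact ⟨fun w hw => by simp [hf w hw, hg w hw], fun w hw => by simp [hf' w hw, hg' w hw]⟩
  smul_mem' := by
    rintro c f ⟨hf, hf'⟩
    exact ⟨fun w hw => by simp [hf w hw], fun w hw => by simp [hf' w hw]⟩

theorem pairFun_mem_highestWeight {N l : ℕ} (s : Fin 2 × Fin l ↪ Fin N) :
    pairFun s ∈ highestWeight N l := by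
  refine ⟨fun w => not_imp_comm.1 weight_eq_of_pairFun_ne_zero, fun w hw => ?_⟩
  obtain ⟨i, hi⟩ : ∃ i, ∀ r, w (s (r, i)) ≠ 0 := by
    by_contra! h
    choose r hr using h
    have hinj : Function.Injective fun i => s (r i, i) := fun i j h =>
      congrArg Prod.snd (s.injective h)
    have := weight_add_card_le (s := Finset.univ.map ⟨_, hinj⟩) (w := w) (by simpa using hr)
    rw [Finset.card_map, Finset.card_univ, Fintype.card_fin] at this
    omega
  refine eq_zero_of_permRep_pairSwap s i ?_
    ((Fin.eq_one_of_ne_zero _ (hi 0)).trans (Fin.eq_one_of_ne_zero _ (hi 1)).symm)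
  rw [← zetaTransform_permRep, permRep_pairSwap_pairFun, map_neg]

theorem pairSpan_le_highestWeight (N l : ℕ) : pairSpan N l ≤ highestWeight N l :=
  Submodule.span_le.2 (by rintro _ ⟨s, rfl⟩; exact pairFun_mem_highestWeight s)

theorem finrank_map_add_finrank_inf_ker {K V W : Type*} [DivisionRing K] [AddCommGroup V]
    [Module K V] [AddCommGroup W] [Module K W] (f : V →ₗ[K] W) (S : Submodule K V)
    [FiniteDimensional K S] :
    Module.finrank K (S.map f) + Module.finrank K (S ⊓ LinearMap.ker f : Submodule K V) =
      Module.finrank K S := by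
  rw [← LinearMap.finrank_range_add_finrank_ker (f.domRestrict S), LinearMap.range_domRestrict,
    LinearMap.ker_domRestrict, (Submodule.equivSubtypeMap S _).finrank_eq,
    Submodule.map_comap_subtype]

/-- Prescribing the first letter of a word. -/
def consRestrict (N : ℕ) (x : Fin 2) :
    ((Fin (N + 1) → Fin 2) → ℂ) →ₗ[ℂ] ((Fin N → Fin 2) → ℂ) :=
  LinearMap.funLeft ℂ ℂ fun u => Fin.cons x u

@[simp] theorem consRestrict_apply {N : ℕ} (x : Fin 2) (f : (Fin (N + 1) → Fin 2) → ℂ)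
    (u : Fin N → Fin 2) : consRestrict N x f u = f (Fin.cons x u) := rfl

theorem eq_of_consRestrict_eq {N : ℕ} {f g : (Fin (N + 1) → Fin 2) → ℂ}
    (h : ∀ x, consRestrict N x f = consRestrict N x g) : f = g := by
  funext w
  rw [← Fin.cons_self_tail w]
  exact congrFun (h (w 0)) (Fin.tail w)

theorem zetaTransform_cons {N : ℕ} (f : (Fin (N + 1) → Fin 2) → ℂ) (x : Fin 2)
    (w : Fin N → Fin 2) :
    zetaTransform _ f (Fin.cons x w) =
      ∑ y ∈ Finset.Iic x, zetaTransform _ (consRestrict N y f) w := by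
  simp only [zetaTransform_apply, ← Finset.sum_product']
  refine (Finset.sum_equiv (Fin.consEquiv fun _ => Fin 2) (fun p => ?_) fun _ _ => rfl).symm
  simp only [Finset.mem_product, Finset.mem_Iic]
  exact (Fin.cons_le_cons (α := fun _ => Fin 2)).symm

theorem zetaTransform_cons_zero {N : ℕ} (f : (Fin (N + 1) → Fin 2) → ℂ) (w : Fin N → Fin 2) :
    zetaTransform _ f (Fin.cons 0 w) = zetaTransform _ (consRestrict N 0 f) w := by
  rw [zetaTransform_cons, show Finset.Iic (0 : Fin 2) = {0} from rfl, Finset.sum_singleton]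

theorem zetaTransform_cons_one {N : ℕ} (f : (Fin (N + 1) → Fin 2) → ℂ) (w : Fin N → Fin 2) :
    zetaTransform _ f (Fin.cons 1 w) =
      zetaTransform _ (consRestrict N 0 f) w + zetaTransform _ (consRestrict N 1 f) w := by
  rw [zetaTransform_cons, show Finset.Iic (1 : Fin 2) = Finset.univ from rfl, Fin.sum_univ_two]

theorem consRestrict_one_mem_highestWeight {N l : ℕ} {f : (Fin (N + 1) → Fin 2) → ℂ}
    (hf : f ∈ highestWeight (N + 1) (l + 1)) : consRestrict N 1 f ∈ highestWeight N l := by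
  obtain ⟨hsupp, hzeta⟩ := hf
  refine ⟨fun u hu => hsupp _ ?_, fun w hw => ?_⟩
  · rw [weight_cons, Fin.val_one]
    omega
  · have hzero := hzeta (Fin.cons 0 w) (by rw [weight_cons, Fin.val_zero]; omega)
    have hone := hzeta (Fin.cons 1 w) (by rw [weight_cons, Fin.val_one]; omega)
    rwa [zetaTransform_cons_one, ← zetaTransform_cons_zero, hzero, zero_add] at hone

theorem consRestrict_zero_mem_highestWeight {N l : ℕ} {f : (Fin (N + 1) → Fin 2) → ℂ}
    (hf : f ∈ highestWeight (N + 1) l) (h₁ : consRestrict N 1 f = 0) :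
    consRestrict N 0 f ∈ highestWeight N l := by
  obtain ⟨hsupp, hzeta⟩ := hf
  refine ⟨fun u hu => hsupp _ ?_, fun w hw => ?_⟩
  · rwa [weight_cons, Fin.val_zero, zero_add]
  · have hone := hzeta (Fin.cons 1 w) (by rw [weight_cons, Fin.val_one]; omega)
    rwa [zetaTransform_cons_one, h₁, map_zero, Pi.zero_apply, add_zero] at hone

theorem highestWeight_eq_bot {N l : ℕ} (h : N < 2 * l) : highestWeight N l = ⊥ := by
  refine (Submodule.eq_bot_iff _).2 fun f ⟨hsupp, hzeta⟩ => funext fun w => ?_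
  by_cases hw : weight w = l
  · have hzeta_eq : zetaTransform _ f w = f w :=
      Finset.sum_eq_single_of_mem w (Finset.mem_Iic.2 le_rfl) fun u hu hne =>
        hsupp u fun hu' => hne (eq_of_le_of_weight_eq (Finset.mem_Iic.1 hu) (hu'.trans hw.symm))
    rw [← hzeta_eq, hzeta w (by omega), Pi.zero_apply]
  · exact hsupp w hw

theorem finrank_highestWeight_zero_le (N : ℕ) : Module.finrank ℂ (highestWeight N 0) ≤ 1 := by
  have hinj : Function.Injective
      ((LinearMap.proj (0 : Fin N → Fin 2) : _ →ₗ[ℂ] ℂ).domRestrict (highestWeight N 0)) := by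
    refine (injective_iff_map_eq_zero _).2 fun ⟨f, hsupp, _⟩ h₀ => Subtype.ext <| funext fun w => ?_
    by_cases hw : weight w = 0
    · obtain rfl : 0 = w :=
        eq_of_le_of_weight_eq (fun i => Fin.zero_le _) (hw ▸ by simp [weight])
      exact h₀
    · exact hsupp w hw
  simpa using LinearMap.finrank_le_finrank_of_injective hinj

theorem finrank_highestWeight_succ_le (N l : ℕ) :
    Module.finrank ℂ (highestWeight (N + 1) (l + 1)) ≤
      Module.finrank ℂ (highestWeight N (l + 1)) + Module.finrank ℂ (highestWeight N l) := by
  rw [← finrank_map_add_finrank_inf_ker (consRestrict N 1), add_comm]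
  refine add_le_add (LinearMap.finrank_le_finrank_of_injective
    (f := (consRestrict N 0).restrict fun f hf =>
      consRestrict_zero_mem_highestWeight hf.1 hf.2) fun f g hfg => ?_) (Submodule.finrank_mono ?_)
  · refine Subtype.ext (eq_of_consRestrict_eq (Fin.forall_fin_two.2 ⟨congrArg Subtype.val hfg, ?_⟩))
    exact (LinearMap.mem_ker.1 f.2.2).trans (LinearMap.mem_ker.1 g.2.2).symm
  · rintro _ ⟨f, hf, rfl⟩
    exact consRestrict_one_mem_highestWeight hf

theorem finrank_highestWeight_le (N l : ℕ) :
    Module.finrank ℂ (highestWeight N l) ≤ ballot N l := by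
  induction N generalizing l with
  | zero =>
    rcases l with _ | l
    · simpa [ballot] using finrank_highestWeight_zero_le 0
    · rw [highestWeight_eq_bot (by omega), finrank_bot]
      exact Nat.zero_le _
  | succ N ih =>
    rcases l with _ | l
    · simpa [ballot] using finrank_highestWeight_zero_le (N + 1)
    rw [ballot]
    split_ifs with h
    · exact (finrank_highestWeight_succ_le N l).trans (add_le_add (ih (l + 1)) (ih l))
    · rw [highestWeight_eq_bot (by omega), finrank_bot]

/-- Extending a function by zero to words whose first letter is not `0`. -/
def consExtend (N : ℕ) : ((Fin N → Fin 2) → ℂ) →ₗ[ℂ] ((Fin (N + 1) → Fin 2) → ℂ) where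
  toFun f w := (1 - bit (w 0)) * f (Fin.tail w)
  map_add' f g := by funext w; simp [mul_add]
  map_smul' c f := by funext w; simp [mul_left_comm]

theorem consExtend_apply {N : ℕ} (f : (Fin N → Fin 2) → ℂ) (w : Fin (N + 1) → Fin 2) :
    consExtend N f w = (1 - bit (w 0)) * f (Fin.tail w) := rfl

theorem consRestrict_zero_consExtend {N : ℕ} (f : (Fin N → Fin 2) → ℂ) :
    consRestrict N 0 (consExtend N f) = f := by
  funext u; simp [consExtend_apply]

theorem consRestrict_one_consExtend {N : ℕ} (f : (Fin N → Fin 2) → ℂ) :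
    consRestrict N 1 (consExtend N f) = 0 := by
  funext u; simp [consExtend_apply]

theorem consExtend_injective (N : ℕ) : Function.Injective (consExtend N) :=
  Function.LeftInverse.injective consRestrict_zero_consExtend

theorem consExtend_pairFun {N l : ℕ} (s : Fin 2 × Fin l ↪ Fin N) :
    consExtend N (pairFun s) = pairFun (s.trans (Fin.succEmb N)) := by
  funext w
  have hcompl : (Finset.univ.map (s.trans (Fin.succEmb N)))ᶜ =
      Finset.cons 0 ((Finset.univ.map s)ᶜ.map (Fin.succEmb N)) (by simp [Fin.succ_ne_zero]) := by
    ext c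
    refine Fin.cases ?_ (fun c => ?_) c <;> simp [Fin.succ_ne_zero]
  rw [consExtend_apply, pairFun, pairFun, hcompl, Finset.prod_cons, Finset.prod_map]
  simp only [Fin.tail, Function.Embedding.trans_apply, Fin.coe_succEmb]
  ring

/-- Adding the pair that consists of the place `c` and the new first place. -/
def addPair {N l : ℕ} (s : Fin 2 × Fin l ↪ Fin N) (c : Fin N) (hc : ∀ p, s p ≠ c) :
    Fin 2 × Fin (l + 1) ↪ Fin (N + 1) where
  toFun p := Fin.cases (if p.1 = 0 then c.succ else 0) (fun i => (s (p.1, i)).succ) p.2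
  inj' := by
    rintro ⟨r, i⟩ ⟨q, j⟩
    refine Fin.cases ?_ (fun i => ?_) i <;> refine Fin.cases ?_ (fun j => ?_) j
    · fin_cases r <;> fin_cases q <;> simp [Fin.succ_ne_zero, (Fin.succ_ne_zero _).symm]
    · fin_cases r <;> simp [(hc _).symm, (Fin.succ_ne_zero _).symm]
    · fin_cases q <;> simp [hc, Fin.succ_ne_zero]
    · simp

section AddPair

variable {N l : ℕ} (s : Fin 2 × Fin l ↪ Fin N) (c : Fin N) (hc : ∀ p, s p ≠ c)

@[simp] theorem addPair_zero_zero : addPair s c hc (0, 0) = c.succ := rfl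

@[simp] theorem addPair_one_zero : addPair s c hc (1, 0) = 0 := rfl

@[simp] theorem addPair_succ (r : Fin 2) (i : Fin l) :
    addPair s c hc (r, i.succ) = (s (r, i)).succ := rfl

theorem compl_map_addPair : (Finset.univ.map (addPair s c hc))ᶜ =
    ((Finset.univ.map s)ᶜ.erase c).map (Fin.succEmb N) := by
  have hforall (d : Fin (N + 1)) : (∀ p, addPair s c hc p ≠ d) ↔
      0 ≠ d ∧ c.succ ≠ d ∧ ∀ p, (s p).succ ≠ d := by
    simp only [Prod.forall, Fin.forall_fin_two]
    simp only [Fin.forall_fin_succ, addPair_zero_zero, addPair_one_zero, addPair_succ]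
    tauto
  have hcompl {m n : ℕ} (e : Fin 2 × Fin m ↪ Fin n) (d : Fin n) :
      d ∈ (Finset.univ.map e)ᶜ ↔ ∀ p, e p ≠ d := by simp
  ext d
  rw [hcompl, hforall]
  refine Fin.cases ?_ (fun d => ?_) d
  · simp [Fin.succ_ne_zero]
  · simp [(Fin.succ_ne_zero _).symm, eq_comm (a := c)]

theorem consRestrict_pairFun_addPair :
    consRestrict N 1 (pairFun (addPair s c hc)) = pairFun s := by
  funext u
  have hcm : c ∈ (Finset.univ.map s)ᶜ := by simpa using hc
  rw [consRestrict_apply, pairFun, pairFun, compl_map_addPair, Finset.prod_map,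
    Fin.prod_univ_succ, ← Finset.mul_prod_erase _ _ hcm]
  simp only [addPair_zero_zero, addPair_one_zero, addPair_succ, Fin.cons_zero, Fin.cons_succ,
    Fin.coe_succEmb, bit_one]
  ring

end AddPair

theorem pairSpan_le_map_consRestrict {N l : ℕ} (h : 2 * l < N) :
    pairSpan N l ≤ (pairSpan (N + 1) (l + 1)).map (consRestrict N 1) := by
  refine Submodule.span_le.2 ?_
  rintro _ ⟨s, rfl⟩
  obtain ⟨c, hc⟩ : ∃ c, ∀ p, s p ≠ c := by
    by_contra! hs
    have := Fintype.card_le_of_surjective s hs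
    rw [Fintype.card_prod, Fintype.card_fin, Fintype.card_fin, Fintype.card_fin] at this
    omega
  exact ⟨_, Submodule.subset_span ⟨addPair s c hc, rfl⟩, consRestrict_pairFun_addPair s c hc⟩

theorem consExtend_mem_pairSpan {N l : ℕ} {f : (Fin N → Fin 2) → ℂ} (hf : f ∈ pairSpan N l) :
    consExtend N f ∈ pairSpan (N + 1) l := by
  suffices h : pairSpan N l ≤ (pairSpan (N + 1) l).comap (consExtend N) from h hf
  refine Submodule.span_le.2 ?_
  rintro _ ⟨s, rfl⟩
  exact Submodule.subset_span ⟨_, (consExtend_pairFun s).symm⟩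

theorem one_le_finrank_pairSpan_zero (N : ℕ) : 1 ≤ Module.finrank ℂ (pairSpan N 0) := by
  rw [Submodule.one_le_finrank_iff, Submodule.ne_bot_iff]
  let s : Fin 2 × Fin 0 ↪ Fin N := Function.Embedding.ofIsEmpty
  refine ⟨pairFun s, Submodule.subset_span ⟨s, rfl⟩, fun h => ?_⟩
  have := congrFun h 0
  simp [pairFun] at this

theorem le_finrank_pairSpan_succ {N l : ℕ} (h : 2 * l < N) :
    Module.finrank ℂ (pairSpan N (l + 1)) + Module.finrank ℂ (pairSpan N l) ≤
      Module.finrank ℂ (pairSpan (N + 1) (l + 1)) := by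
  rw [← finrank_map_add_finrank_inf_ker (consRestrict N 1), add_comm]
  refine add_le_add (Submodule.finrank_mono (pairSpan_le_map_consRestrict h))
    (LinearMap.finrank_le_finrank_of_injective (f := (consExtend N).restrict fun f hf =>
      ⟨consExtend_mem_pairSpan hf, consRestrict_one_consExtend f⟩) fun f g hfg => ?_)
  exact Subtype.ext (consExtend_injective N (congrArg Subtype.val hfg))

theorem ballot_le_finrank_pairSpan (N l : ℕ) :
    ballot N l ≤ Module.finrank ℂ (pairSpan N l) := by
  induction N generalizing l with
  | zero =>
    rcases l with _ | l
    · simpa [ballot] using one_le_finrank_pairSpan_zero 0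
    · simp [ballot]
  | succ N ih =>
    rcases l with _ | l
    · simpa [ballot] using one_le_finrank_pairSpan_zero (N + 1)
    rw [ballot]
    split_ifs with h
    · exact (add_le_add (ih (l + 1)) (ih l)).trans (le_finrank_pairSpan_succ (by omega))
    · exact Nat.zero_le _

theorem finrank_pairSpan (N l : ℕ) : Module.finrank ℂ (pairSpan N l) = ballot N l :=
  le_antisymm ((Submodule.finrank_mono (pairSpan_le_highestWeight N l)).trans
    (finrank_highestWeight_le N l)) (ballot_le_finrank_pairSpan N l)

/-! ### Specht modules of two-row frames -/

/-- The matrix, indexed by the entries of the tableau, that tells whether `i` and `j` are in the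
same column and `w` puts `i` in the row of `j`; its determinant is the value of the polytabloid of
`t` at `w`. -/
def columnMatrix {N : ℕ} {μ : N.Partition} (t : Tableau μ) (w : Fin N → ℕ) :
    Matrix (Fin N) (Fin N) ℂ :=
  Matrix.of fun i j => if (t i).1.2 = (t j).1.2 ∧ w i = (t j).1.1 then 1 else 0

theorem polytabloid_apply {N : ℕ} {μ : N.Partition} (t : Tableau μ) (w : Fin N → ℕ) :
    polytabloid t w = (columnMatrix t w).det := by
  rw [Matrix.det_apply', polytabloid, Finset.sum_apply, Finset.sum_filter]
  refine Finset.sum_congr rfl fun σ _ => ?_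
  have hw : w = (fun i => (t i).1.1) ∘ σ.symm ↔ ∀ i, w (σ i) = (t i).1.1 := by
    rw [← Equiv.comp_symm_eq, Equiv.symm_symm, funext_iff]
    rfl
  simp only [columnMatrix, Matrix.of_apply, Finset.prod_ite_zero, Finset.prod_const_one,
    Pi.smul_apply, permRep_single, smul_eq_mul, Pi.single_apply, hw, Finset.mem_univ, true_implies,
    ite_and, mul_ite, mul_zero]

theorem polytabloid_eq_zero {N : ℕ} {μ : N.Partition} (t : Tableau μ) {w : Fin N → ℕ} {i : Fin N}
    (hi : ∀ j, w i ≠ (t j).1.1) : polytabloid t w = 0 := by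
  rw [polytabloid_apply]
  exact Matrix.det_eq_zero_of_row_eq_zero i fun j => if_neg fun h => hi j h.2

/-- The boxes of `(N - l, l)`: the columns of length two, and the remaining boxes of the first
row. -/
def cellEquiv (N l : ℕ) (hl : 2 * l ≤ N) :
    (Fin 2 × Fin l) ⊕ Fin (N - 2 * l) ≃ (diagram (twoRow N l hl).1).cells :=
  Equiv.ofBijective
    (Sum.elim
      (fun x => ⟨(x.1.val, x.2.val), by
        rw [YoungDiagram.mem_cells, mem_diagram_twoRow]
        dsimp only
        omega⟩)
      (fun c => ⟨(0, l + c.val), by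
        rw [YoungDiagram.mem_cells, mem_diagram_twoRow]
        dsimp only
        omega⟩))
    ⟨by
      rintro (⟨r, i⟩ | c) (⟨q, j⟩ | d) h <;>
        simp only [Sum.elim_inl, Sum.elim_inr, Subtype.mk.injEq, Prod.mk.injEq] at h
      · rw [Fin.ext h.1, Fin.ext h.2]
      · omega
      · omega
      · rw [Fin.ext (by omega : c.val = d.val)],
    by
      rintro ⟨⟨i, j⟩, h⟩
      have h' := h
      rw [YoungDiagram.mem_cells, mem_diagram_twoRow] at h'
      dsimp only at h'
      by_cases hj : j < l
      · exact ⟨Sum.inl (⟨i, by omega⟩, ⟨j, hj⟩), rfl⟩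
      · refine ⟨Sum.inr ⟨j - l, by omega⟩, Subtype.ext (Prod.ext ?_ ?_)⟩
        · simp only [Sum.elim_inr]; omega
        · simp only [Sum.elim_inr]; omega⟩

section TwoRowTableau

variable {N l : ℕ} {hl : 2 * l ≤ N}

variable (t : Tableau (twoRow N l hl).1)

/-- The entries of a tableau of shape `(N - l, l)` in terms of its boxes. -/
def entryEquiv : (Fin 2 × Fin l) ⊕ Fin (N - 2 * l) ≃ Fin N := (cellEquiv N l hl).trans t.symm

/-- The columns of length two of a tableau of shape `(N - l, l)`. -/
def pairEmb : Fin 2 × Fin l ↪ Fin N := Function.Embedding.inl.trans (entryEquiv t).toEmbedding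

/-- The columns of length one of a tableau of shape `(N - l, l)`. -/
def singleEmb : Fin (N - 2 * l) ↪ Fin N :=
  Function.Embedding.inr.trans (entryEquiv t).toEmbedding

theorem entryEquiv_inl (p : Fin 2 × Fin l) : entryEquiv t (Sum.inl p) = pairEmb t p := rfl

theorem entryEquiv_inr (c : Fin (N - 2 * l)) : entryEquiv t (Sum.inr c) = singleEmb t c := rfl

@[simp] theorem apply_pairEmb (p : Fin 2 × Fin l) :
    (t (pairEmb t p)).1 = (p.1.val, p.2.val) :=
  congrArg Subtype.val (t.apply_symm_apply _)

@[simp] theorem apply_singleEmb (c : Fin (N - 2 * l)) :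
    (t (singleEmb t c)).1 = (0, l + c.val) :=
  congrArg Subtype.val (t.apply_symm_apply _)

theorem compl_map_pairEmb :
    (Finset.univ.map (pairEmb t))ᶜ = Finset.univ.map (singleEmb t) := by
  ext c
  obtain ⟨x, rfl⟩ := (entryEquiv t).surjective c
  rcases x with x | x <;> simp [← entryEquiv_inl, ← entryEquiv_inr]

theorem pairFun_pairEmb (w : Fin N → Fin 2) :
    pairFun (pairEmb t) w = (∏ i, (bit (w (pairEmb t (1, i))) - bit (w (pairEmb t (0, i))))) *
      ∏ c, (1 - bit (w (singleEmb t c))) := by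
  rw [pairFun, compl_map_pairEmb, Finset.prod_map]

theorem columnMatrix_submatrix_entryEquiv (w : Fin N → Fin 2) :
    (columnMatrix t fun i => (w i).val).submatrix (entryEquiv t) (entryEquiv t) =
      Matrix.fromBlocks
        (Matrix.blockDiagonal fun i => Matrix.of fun r q : Fin 2 =>
          if w (pairEmb t (r, i)) = q then 1 else 0) 0 0
        (Matrix.diagonal fun c => if w (singleEmb t c) = 0 then 1 else 0) := by
  ext (⟨r, i⟩ | c) (⟨q, j⟩ | d) <;>
    simp only [columnMatrix, Matrix.submatrix_apply, Matrix.of_apply, entryEquiv_inl,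
      entryEquiv_inr, apply_pairEmb, apply_singleEmb, Matrix.fromBlocks_apply₁₁,
      Matrix.fromBlocks_apply₁₂, Matrix.fromBlocks_apply₂₁, Matrix.fromBlocks_apply₂₂,
      Matrix.blockDiagonal_apply, Matrix.diagonal_apply, Matrix.zero_apply]
  · simp only [Fin.val_inj, ite_and]
  · exact if_neg (by omega)
  · exact if_neg (by omega)
  · simp only [add_right_inj, Fin.val_inj, Fin.val_eq_zero_iff, ite_and]

theorem polytabloid_val (w : Fin N → Fin 2) :
    polytabloid t (fun i => (w i).val) = pairFun (pairEmb t) w := by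
  have hpair (x y : Fin 2) : (Matrix.of fun r q : Fin 2 =>
      if ![x, y] r = q then (1 : ℂ) else 0).det = bit y - bit x := by
    rw [Matrix.det_fin_two]
    fin_cases x <;> fin_cases y <;> simp
  have hsingle (x : Fin 2) : (if x = 0 then (1 : ℂ) else 0) = 1 - bit x := by
    fin_cases x <;> simp
  rw [polytabloid_apply, ← Matrix.det_submatrix_equiv_self (entryEquiv t),
    columnMatrix_submatrix_entryEquiv, Matrix.det_fromBlocks_zero₂₁, Matrix.det_blockDiagonal,
    Matrix.det_diagonal, pairFun_pairEmb]
  congr 1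
  · refine Finset.prod_congr rfl fun i _ => ?_
    rw [← hpair]
    congr
    ext r q
    fin_cases r <;> rfl
  · exact Finset.prod_congr rfl fun c _ => hsingle _

end TwoRowTableau

theorem exists_pairEmb_eq {N l : ℕ} (hl : 2 * l ≤ N) (s : Fin 2 × Fin l ↪ Fin N) :
    ∃ t : Tableau (twoRow N l hl).1, pairEmb t = s := by
  classical
  have hcard : Fintype.card ((Set.range s)ᶜ : Set (Fin N)) = N - 2 * l := by
    rw [Fintype.card_compl_set, Set.card_range_of_injective s.injective]
    simp
  let e : (Fin 2 × Fin l) ⊕ Fin (N - 2 * l) ≃ Fin N :=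
    (Equiv.sumCongr (Equiv.ofInjective s s.injective)
      (Fintype.equivFinOfCardEq hcard).symm).trans (Equiv.Set.sumCompl (Set.range s))
  refine ⟨e.symm.trans (cellEquiv N l hl), ?_⟩
  ext p
  simp [← entryEquiv_inl, entryEquiv, e]

/-- Restricting a function on words to binary words. -/
def binaryRestrict (N : ℕ) : ((Fin N → ℕ) → ℂ) →ₗ[ℂ] ((Fin N → Fin 2) → ℂ) :=
  LinearMap.funLeft ℂ ℂ fun w i => (w i).val

theorem binaryRestrict_permRep {N : ℕ} (σ : Equiv.Perm (Fin N)) (f : (Fin N → ℕ) → ℂ) :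
    binaryRestrict N (permRep N ℕ σ f) = permRep N (Fin 2) σ (binaryRestrict N f) := rfl

theorem binaryRestrict_polytabloid {N l : ℕ} {hl : 2 * l ≤ N} (t : Tableau (twoRow N l hl).1) :
    binaryRestrict N (polytabloid t) = pairFun (pairEmb t) :=
  funext fun w => polytabloid_val t w

theorem map_binaryRestrict_specht {N l : ℕ} (hl : 2 * l ≤ N) :
    (specht (twoRow N l hl).1).toSubmodule.map (binaryRestrict N) = pairSpan N l := by
  have hsurj : Function.Surjective (pairEmb (hl := hl)) := exists_pairEmb_eq hl
  rw [specht, pairSpan, Submodule.map_span, ← Set.range_comp, ← hsurj.range_comp pairFun]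
  exact congrArg _ (congrArg _ (funext binaryRestrict_polytabloid))

theorem eq_zero_of_mem_specht_twoRow {N l : ℕ} {hl : 2 * l ≤ N} {f : (Fin N → ℕ) → ℂ}
    (hf : f ∈ (specht (twoRow N l hl).1).toSubmodule) {w : Fin N → ℕ} {i : Fin N}
    (hi : 2 ≤ w i) : f w = 0 := by
  suffices h : (specht (twoRow N l hl).1).toSubmodule ≤ LinearMap.ker (LinearMap.proj w) from h hf
  refine Submodule.span_le.2 ?_
  rintro _ ⟨t, rfl⟩
  refine polytabloid_eq_zero t (i := i) fun j h => ?_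
  have := (t j).2
  rw [YoungDiagram.mem_cells, mem_diagram_twoRow] at this
  omega

theorem disjoint_specht_ker_binaryRestrict {N l : ℕ} (hl : 2 * l ≤ N) :
    Disjoint (specht (twoRow N l hl).1).toSubmodule (LinearMap.ker (binaryRestrict N)) := by
  refine Submodule.disjoint_def.2 fun f hf h₀ => funext fun w => ?_
  by_cases! hw : ∃ i, 2 ≤ w i
  · obtain ⟨i, hi⟩ := hw
    exact eq_zero_of_mem_specht_twoRow hf hi
  · exact congrFun (LinearMap.mem_ker.1 h₀) fun i => ⟨w i, hw i⟩

theorem dimIrrep_twoRow {N l : ℕ} (hl : 2 * l ≤ N) : dimIrrep (twoRow N l hl).1 = ballot N l := by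
  rw [← finrank_pairSpan, ← map_binaryRestrict_specht hl, dimIrrep,
    ← finrank_map_add_finrank_inf_ker (binaryRestrict N),
    (disjoint_specht_ker_binaryRestrict hl).eq_bot, finrank_bot, add_zero]

/-! ### Multiplicities of two-row frames -/

theorem eq_zero_of_forall_permRep_pairSwap {N l : ℕ} {s : Fin 2 × Fin l ↪ Fin N}
    {g : (Fin N → Fin 2) → ℂ} (hg : ∀ i, permRep N (Fin 2) (pairSwap s i) g = -g)
    (h₀ : ∀ w, (∀ p, w (s p) = p.1) → g w = 0) : g = 0 := by
  suffices h : ∀ (T : Finset (Fin l)) (w : Fin N → Fin 2), (∀ i ∉ T, w (s (0, i)) = 0) → g w = 0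
    from funext fun w => h Finset.univ w (by simp)
  intro T
  induction T using Finset.induction_on with
  | empty =>
    intro w hw
    by_cases! hne : ∃ i, w (s (1, i)) = 0
    · obtain ⟨i, hi⟩ := hne
      exact eq_zero_of_permRep_pairSwap s i (hg i) ((hw i (Finset.notMem_empty i)).trans hi.symm)
    · refine h₀ w (Prod.forall.2 (Fin.forall_fin_two.2 ⟨fun i => ?_, fun i => ?_⟩))
      · exact hw i (Finset.notMem_empty i)
      · exact Fin.eq_one_of_ne_zero _ (hne i)
  | insert i T _ ih =>
    intro w hw
    by_cases heq : w (s (0, i)) = w (s (1, i))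
    · exact eq_zero_of_permRep_pairSwap s i (hg i) heq
    by_cases hi : w (s (0, i)) = 0
    · refine ih w fun j hj => ?_
      rcases eq_or_ne j i with rfl | hji
      · exact hi
      · exact hw j (by simp [hj, hji])
    · have hi₁ : w (s (1, i)) = 0 := by omega
      refine neg_eq_zero.1 ((congrFun (hg i) w).symm.trans
        (ih (w ∘ pairSwap s i) fun j hj => ?_))
      rcases eq_or_ne j i with rfl | hji
      · rw [Function.comp_apply, pairSwap_apply_zero, hi₁]
      · rw [Function.comp_apply, pairSwap_apply_of_ne s i hji, hw j (by simp [hj, hji])]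

/-- The word with `k` ones followed by zeros. -/
def threshold (m k : ℕ) (c : Fin m) : Fin 2 := if c.val < k then 1 else 0

theorem weight_threshold {m k : ℕ} (hk : k ≤ m) : weight (threshold m k) = k := by
  simp only [weight, threshold, apply_ite Fin.val, Fin.val_one, Fin.val_zero]
  rw [← Finset.card_filter, Fin.card_filter_val_lt, min_eq_right hk]

theorem exists_comp_perm_eq_threshold {m : ℕ} (x : Fin m → Fin 2) :
    ∃ (k : Fin (m + 1)) (ρ : Equiv.Perm (Fin m)), x ∘ ρ = threshold m k := by
  have hle : Fintype.card {c // x c = 1} ≤ m := by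
    simpa using Fintype.card_subtype_le fun c => x c = 1
  let k : Fin (m + 1) := ⟨Fintype.card {c // x c = 1}, by omega⟩
  have hcard : Fintype.card {c : Fin m // c.val < k.val} = Fintype.card {c // x c = 1} := by
    rw [Fintype.card_subtype, Fin.card_filter_val_lt]
    exact min_eq_right hle
  let e := Fintype.equivOfCardEq hcard
  refine ⟨k, e.extendSubtype, funext fun c => ?_⟩
  rw [Function.comp_apply, threshold]
  split_ifs with h
  · exact e.extendSubtype_mem c h
  · have := e.extendSubtype_not_mem c h
    omega

/-- The projection onto the functions supported on words with `n` ones. -/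
def weightProj (N n : ℕ) : ((Fin N → Fin 2) → ℂ) →ₗ[ℂ] ((Fin N → Fin 2) → ℂ) where
  toFun f w := if weight w = n then f w else 0
  map_add' f g := by
    funext w
    simp only [Pi.add_apply, ite_add_zero]
  map_smul' c f := by
    funext w
    simp only [Pi.smul_apply, smul_ite, smul_zero, RingHom.id_apply]

theorem weightProj_apply {N n : ℕ} (f : (Fin N → Fin 2) → ℂ) (w : Fin N → Fin 2) :
    weightProj N n f w = if weight w = n then f w else 0 := rfl

theorem weightProj_permRep {N n : ℕ} (σ : Equiv.Perm (Fin N)) (f : (Fin N → Fin 2) → ℂ) :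
    weightProj N n (permRep N (Fin 2) σ f) = permRep N (Fin 2) σ (weightProj N n f) := by
  funext w
  simp only [weightProj_apply, permRep_apply, weight_comp_perm]

section TwoRowTableau

variable {N l : ℕ} {hl : 2 * l ≤ N} (t : Tableau (twoRow N l hl).1)

/-- The binary word with the letters `0` and `1` in the columns of length two of a tableau and the
letters `x` in the columns of length one. -/
def boxWord (x : Fin (N - 2 * l) → Fin 2) : Fin N → Fin 2 :=
  Sum.elim Prod.fst x ∘ (entryEquiv t).symm

@[simp] theorem boxWord_pairEmb (x : Fin (N - 2 * l) → Fin 2) (p : Fin 2 × Fin l) :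
    boxWord t x (pairEmb t p) = p.1 := by
  simp [boxWord, ← entryEquiv_inl]

@[simp] theorem boxWord_singleEmb (x : Fin (N - 2 * l) → Fin 2) (c : Fin (N - 2 * l)) :
    boxWord t x (singleEmb t c) = x c := by
  simp [boxWord, ← entryEquiv_inr]

theorem forall_entry {P : Fin N → Prop} :
    (∀ j, P j) ↔ (∀ p, P (pairEmb t p)) ∧ ∀ c, P (singleEmb t c) :=
  (entryEquiv t).forall_congr_right.symm.trans Sum.forall

theorem eq_boxWord {w : Fin N → Fin 2} {x : Fin (N - 2 * l) → Fin 2}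
    (hpair : ∀ p, w (pairEmb t p) = p.1) (hsingle : ∀ c, w (singleEmb t c) = x c) :
    w = boxWord t x :=
  funext <| (forall_entry t).2 ⟨fun p => by rw [hpair, boxWord_pairEmb],
    fun c => by rw [hsingle, boxWord_singleEmb]⟩

theorem weight_boxWord (x : Fin (N - 2 * l) → Fin 2) : weight (boxWord t x) = l + weight x := by
  rw [weight, ← (entryEquiv t).sum_comp, Fintype.sum_sum_type, Fintype.sum_prod_type]
  simp [boxWord, weight]

theorem zetaTransform_pairFun_boxWord (x : Fin (N - 2 * l) → Fin 2) :
    zetaTransform _ (pairFun (pairEmb t)) (boxWord t x) = 1 := by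
  have hmem : boxWord t 0 ∈ Finset.Iic (boxWord t x) :=
    Finset.mem_Iic.2 ((forall_entry t).2 ⟨by simp, by simp⟩)
  rw [zetaTransform_apply, Finset.sum_eq_single_of_mem _ hmem fun u hu => ?_]
  · rw [pairFun_pairEmb]
    simp
  refine not_imp_comm.1 fun h => ?_
  obtain ⟨hpair, hsingle⟩ := pairFun_ne_zero_iff.1 h
  have hzero (i : Fin l) : u (pairEmb t (0, i)) = 0 := by
    simpa using Finset.mem_Iic.1 hu (pairEmb t (0, i))
  refine eq_boxWord t (Prod.forall.2 (Fin.forall_fin_two.2 ⟨hzero, fun i => ?_⟩)) fun c => ?_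
  · have := hpair i
    rw [hzero] at this
    exact Fin.ext this
  · exact hsingle _ fun p => (entryEquiv t).injective.ne Sum.inl_ne_inr

/-- The permutation of the entries of a tableau that permutes its columns of length one. -/
def singlePerm (ρ : Equiv.Perm (Fin (N - 2 * l))) : Equiv.Perm (Fin N) :=
  (entryEquiv t).permCongr (Equiv.sumCongr 1 ρ)

@[simp] theorem singlePerm_pairEmb (ρ : Equiv.Perm (Fin (N - 2 * l))) (p : Fin 2 × Fin l) :
    singlePerm t ρ (pairEmb t p) = pairEmb t p := by
  simp [singlePerm, ← entryEquiv_inl, Equiv.permCongr_apply]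

@[simp] theorem singlePerm_singleEmb (ρ : Equiv.Perm (Fin (N - 2 * l))) (c : Fin (N - 2 * l)) :
    singlePerm t ρ (singleEmb t c) = singleEmb t (ρ c) := by
  simp [singlePerm, ← entryEquiv_inr, Equiv.permCongr_apply]

theorem permRep_singlePerm_pairFun (ρ : Equiv.Perm (Fin (N - 2 * l))) :
    permRep N (Fin 2) (singlePerm t ρ) (pairFun (pairEmb t)) = pairFun (pairEmb t) := by
  funext w
  simp only [permRep_apply, pairFun_pairEmb, Function.comp_apply, singlePerm_pairEmb,
    singlePerm_singleEmb]
  rw [Equiv.prod_comp ρ fun c => 1 - bit (w (singleEmb t c))]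

theorem eq_zero_of_boxWord_threshold {g : (Fin N → Fin 2) → ℂ}
    (hswap : ∀ i, permRep N (Fin 2) (pairSwap (pairEmb t) i) g = -g)
    (hsingle : ∀ ρ, permRep N (Fin 2) (singlePerm t ρ) g = g)
    (h₀ : ∀ k : Fin (N - 2 * l + 1), g (boxWord t (threshold _ k)) = 0) : g = 0 := by
  refine eq_zero_of_forall_permRep_pairSwap hswap fun w hw => ?_
  obtain ⟨k, ρ, hρ⟩ := exists_comp_perm_eq_threshold (w ∘ singleEmb t)
  have hbox : w ∘ singlePerm t ρ = boxWord t (threshold _ k) :=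
    eq_boxWord t (fun p => by simp [hw]) fun c => by simp [← hρ]
  rw [← hsingle ρ, permRep_apply, hbox, h₀]

/-- The generator of the Specht module given by a tableau. -/
def spechtGen {μ : N.Partition} (t : Tableau μ) : (specht μ).toSubmodule :=
  ⟨polytabloid t, Submodule.subset_span ⟨t, rfl⟩⟩

theorem toRepresentation_spechtGen {μ : N.Partition} (t t' : Tableau μ) :
    (specht μ).toRepresentation (t.trans t'.symm) (spechtGen t) = spechtGen t' := by
  refine Subtype.ext ((permRep_polytabloid _ t).trans (congrArg polytabloid ?_))
  ext1 j
  exact t.apply_symm_apply _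

theorem span_range_spechtGen (μ : N.Partition) :
    Submodule.span ℂ (Set.range (spechtGen (μ := μ))) = ⊤ := by
  refine Submodule.map_injective_of_injective (specht μ).toSubmodule.injective_subtype ?_
  rw [Submodule.map_span, ← Set.range_comp, Submodule.map_subtype_top]
  rfl

theorem eq_zero_of_apply_spechtGen_eq_zero {μ : N.Partition} {W : Type*} [AddCommGroup W]
    [Module ℂ W] {ρ : Representation ℂ (Equiv.Perm (Fin N)) W} {t : Tableau μ}
    {F : Representation.IntertwiningMap (specht μ).toRepresentation ρ}
    (hF : F (spechtGen t) = 0) : F = 0 := by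
  suffices h : F.toLinearMap = 0 from DFunLike.ext _ _ fun f => LinearMap.congr_fun h f
  refine LinearMap.ext_on_range (span_range_spechtGen μ) fun t' => ?_
  change F (spechtGen t') = 0
  rw [← toRepresentation_spechtGen t t', Representation.IntertwiningMap.isIntertwining, hF,
    map_zero]

theorem binaryRestrict_subtype_injective :
    Function.Injective
      (binaryRestrict N ∘ₗ (specht (twoRow N l hl).1).toSubmodule.subtype) := by
  rw [← LinearMap.ker_eq_bot, LinearMap.ker_comp, ← Submodule.disjoint_iff_comap_eq_bot]
  exact disjoint_specht_ker_binaryRestrict hl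

theorem toRepresentation_pairSwap_spechtGen (i : Fin l) :
    (specht (twoRow N l hl).1).toRepresentation (pairSwap (pairEmb t) i) (spechtGen t) =
      -spechtGen t := by
  refine binaryRestrict_subtype_injective ?_
  change permRep N (Fin 2) _ (binaryRestrict N (polytabloid t)) =
    binaryRestrict N (-polytabloid t)
  rw [map_neg, binaryRestrict_polytabloid, permRep_pairSwap_pairFun]

theorem toRepresentation_singlePerm_spechtGen (ρ : Equiv.Perm (Fin (N - 2 * l))) :
    (specht (twoRow N l hl).1).toRepresentation (singlePerm t ρ) (spechtGen t) =
      spechtGen t := by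
  refine binaryRestrict_subtype_injective ?_
  change permRep N (Fin 2) _ (binaryRestrict N (polytabloid t)) = binaryRestrict N (polytabloid t)
  rw [binaryRestrict_polytabloid, permRep_singlePerm_pairFun]

/-- Evaluation of an equivariant map at a generator of the Specht module, on the words
`boxWord t (threshold _ k)`. -/
def evalGen : Representation.IntertwiningMap (specht (twoRow N l hl).1).toRepresentation
    (permRep N (Fin 2)) →ₗ[ℂ] (Fin (N - 2 * l + 1) → ℂ) where
  toFun F k := F (spechtGen t) (boxWord t (threshold _ k))
  map_add' _ _ := rfl
  map_smul' _ _ := rfl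

theorem evalGen_injective : Function.Injective (evalGen t) := by
  refine (injective_iff_map_eq_zero _).2 fun F hF => eq_zero_of_apply_spechtGen_eq_zero (t := t)
    (eq_zero_of_boxWord_threshold t (fun i => ?_) (fun ρ => ?_) fun k => congrFun hF k)
  · rw [← Representation.IntertwiningMap.isIntertwining, toRepresentation_pairSwap_spechtGen,
      map_neg]
  · rw [← Representation.IntertwiningMap.isIntertwining, toRepresentation_singlePerm_spechtGen]

/-- The equivariant map from a two-row Specht module to the functions on words with `n` ones, given
by the zeta transform. -/
def zetaIntertwining (hl : 2 * l ≤ N) (n : ℕ) :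
    Representation.IntertwiningMap (specht (twoRow N l hl).1).toRepresentation
      (permRep N (Fin 2)) where
  toLinearMap := weightProj N n ∘ₗ zetaTransform _ ∘ₗ binaryRestrict N ∘ₗ
    (specht (twoRow N l hl).1).toSubmodule.subtype
  isIntertwining' σ := LinearMap.ext fun f => by
    change weightProj N n (zetaTransform _ (binaryRestrict N (permRep N ℕ σ f.1))) = _
    rw [binaryRestrict_permRep, zetaTransform_permRep, weightProj_permRep]
    rfl

theorem evalGen_zetaIntertwining (k : Fin (N - 2 * l + 1)) :
    evalGen t (zetaIntertwining hl (l + k)) = Pi.single k 1 := by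
  funext j
  change weightProj N (l + k) (zetaTransform _ (binaryRestrict N (polytabloid t)))
    (boxWord t (threshold _ j)) = _
  rw [weightProj_apply, binaryRestrict_polytabloid, zetaTransform_pairFun_boxWord, weight_boxWord,
    weight_threshold (by omega), Pi.single_apply]
  simp only [add_right_inj, Fin.val_inj]

theorem evalGen_surjective : Function.Surjective (evalGen t) := by
  rw [← LinearMap.range_eq_top, eq_top_iff, ← (Pi.basisFun ℂ _).span_eq, Submodule.span_le]
  rintro _ ⟨k, rfl⟩
  exact ⟨_, (evalGen_zetaIntertwining t k).trans (Pi.basisFun_apply ℂ _ k).symm⟩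

end TwoRowTableau

theorem multIrrep_twoRow {N l : ℕ} (hl : 2 * l ≤ N) :
    multIrrep 2 (twoRow N l hl).1 = N - 2 * l + 1 := by
  have hcard : Fintype.card ((Fin 2 × Fin l) ⊕ Fin (N - 2 * l)) = N := by
    simp only [Fintype.card_sum, Fintype.card_prod, Fintype.card_fin]
    omega
  let t : Tableau (twoRow N l hl).1 :=
    (Fintype.equivFinOfCardEq hcard).symm.trans (cellEquiv N l hl)
  rw [multIrrep, (LinearEquiv.ofBijective (evalGen t)
    ⟨evalGen_injective t, evalGen_surjective t⟩).finrank_eq, Module.finrank_fin_fun]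

/-! ### The qubit fidelity -/

theorem cast_sub_two_mul {N l : ℕ} (hl : 2 * l ≤ N) : ((N - 2 * l : ℕ) : ℝ) = N - 2 * l := by
  rw [Nat.cast_sub hl, Nat.cast_mul, Nat.cast_ofNat]

theorem sqrt_dimIrrep_mul_multIrrep {N l : ℕ} (hl : 2 * l ≤ N) :
    √((dimIrrep (twoRow N l hl).1 : ℝ) * (multIrrep 2 (twoRow N l hl).1 : ℝ)) =
      ((N : ℝ) - 2 * l + 1) / √((N : ℝ) + 1) * √((N + 1).choose l : ℝ) := by
  have hl' : (2 * l : ℝ) ≤ N := by exact_mod_cast hl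
  have h_prod : (ballot N l : ℝ) * ((N : ℝ) - 2 * l + 1) =
      ((N : ℝ) - 2 * l + 1) ^ 2 / ((N : ℝ) + 1) * (N + 1).choose l := by
    field_simp
    linear_combination ((N : ℝ) - 2 * l + 1) * succ_mul_ballot N l (by omega)
  rw [dimIrrep_twoRow, multIrrep_twoRow, Nat.cast_add_one, cast_sub_two_mul hl, h_prod,
    Real.sqrt_mul (by positivity), Real.sqrt_div (by positivity), Real.sqrt_sq (by linarith)]

theorem fidelity_qubit {N : ℕ} {v : Frame N 2 → ℝ} (hv0 : ∀ μ, 0 ≤ v μ) {q : ℕ → ℝ}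
    (hq : ∀ l hl, v (twoRow N l hl) = q l) :
    fidelity (resource N 2) (optimalResource v) =
      1 / √((2 : ℝ) ^ N) * ∑ l ∈ Finset.range (N / 2 + 1),
        q l * (((N : ℝ) - 2 * l + 1) / √((N : ℝ) + 1)) * √((N + 1).choose l : ℝ) := by
  rw [fidelity_resource_optimalResource_of_nonneg hv0, Nat.cast_ofNat]
  congr 1
  refine sum_frame_eq_sum_range fun l hl => ?_
  rw [hq, sqrt_dimIrrep_mul_multIrrep, mul_assoc]

theorem sqrt_choose_eq_sqrt_factorial_div {N l : ℕ} (hl : l ≤ N + 1) :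
    1 / √((2 : ℝ) ^ N) * (1 / √(((N : ℝ) + 2) / 4)) * (1 / √((N : ℝ) + 1)) *
        √((N + 1).choose l : ℝ) =
      √((N.factorial : ℝ) / ((2 : ℝ) ^ ((N : ℤ) - 2) * ((N : ℝ) + 2))) /
        √((l.factorial : ℝ) * ((N + 1 - l).factorial : ℝ)) := by
  have h_choose : ((N + 1).choose l : ℝ) * l.factorial * (N + 1 - l).factorial =
      (N + 1) * N.factorial := by
    have h := Nat.choose_mul_factorial_mul_factorial hl
    rw [Nat.factorial_succ] at h
    exact_mod_cast h
  have h_zpow : (2 : ℝ) ^ ((N : ℤ) - 2) = 2 ^ N / 2 ^ 2 := by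
    rw [zpow_sub₀ two_ne_zero, zpow_natCast, zpow_ofNat]
  rw [h_zpow, ← Real.sqrt_div (by positivity)]
  simp only [one_div, ← Real.sqrt_inv]
  rw [← Real.sqrt_mul (by positivity), ← Real.sqrt_mul (by positivity),
    ← Real.sqrt_mul (by positivity)]
  congr 1
  field_simp
  linear_combination 4 * h_choose

theorem qubitCoeff_summand_eq_spin_summand {N l : ℕ} (hN : 1 ≤ N) (hl : 2 * l ≤ N) :
    1 / √((2 : ℝ) ^ N) *
        (qubitCoeff N l * (((N : ℝ) - 2 * l + 1) / √((N : ℝ) + 1)) * √((N + 1).choose l : ℝ)) =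
      √((N.factorial : ℝ) / ((2 : ℝ) ^ ((N : ℤ) - 2) * ((N : ℝ) + 2))) *
        (((N : ℝ) - 2 * l + 1) * Real.sin (Real.pi * ((N : ℝ) - 2 * l + 1) / ((N : ℝ) + 2)) /
          √((l.factorial : ℝ) * ((N + 1 - l).factorial : ℝ))) := by
  have h_sin : Real.sin (Real.pi * ((N : ℝ) - 2 * l + 1) / ((N : ℝ) + 2)) = sineCoeff N l := by
    rw [sineCoeff]
    ring_nf
  rw [h_sin, qubitCoeff_eq_sineCoeff_div hN hl, sum_sineCoeff_sq hN]
  linear_combination sineCoeff N l * ((N : ℝ) - 2 * l + 1) *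
    sqrt_choose_eq_sqrt_factorial_div (by omega : l ≤ N + 1)

theorem sum_range_half_eq_sum_filter_mod_two {R : Type*} [AddCommMonoid R] (N : ℕ) {f g : ℕ → R}
    (h : ∀ l, 2 * l ≤ N → f l = g (N - 2 * l)) :
    ∑ l ∈ Finset.range (N / 2 + 1), f l =
      ∑ k ∈ Finset.range (N + 1) with k % 2 = N % 2, g k := by
  refine Finset.sum_bij' (fun l _ => N - 2 * l) (fun k _ => (N - k) / 2) ?_ ?_ ?_ ?_
    fun l hl => h l (by rw [Finset.mem_range] at hl; omega)
  all_goals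
    simp only [Finset.mem_filter, Finset.mem_range]
    omega

theorem sum_qubitCoeff_eq_sum_spin {N : ℕ} (hN : 1 ≤ N) :
    1 / √((2 : ℝ) ^ N) * ∑ l ∈ Finset.range (N / 2 + 1),
        qubitCoeff N l * (((N : ℝ) - 2 * l + 1) / √((N : ℝ) + 1)) * √((N + 1).choose l : ℝ) =
      √((N.factorial : ℝ) / ((2 : ℝ) ^ ((N : ℤ) - 2) * ((N : ℝ) + 2))) *
        ∑ k ∈ Finset.range (N + 1) with k % 2 = N % 2,
          ((k : ℝ) + 1) * Real.sin (Real.pi * ((k : ℝ) + 1) / ((N : ℝ) + 2)) /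
            √((((N - k) / 2).factorial : ℝ) * (((N + k) / 2 + 1).factorial : ℝ)) := by
  rw [Finset.mul_sum, Finset.mul_sum]
  refine sum_range_half_eq_sum_filter_mod_two N fun l hl => ?_
  rw [cast_sub_two_mul hl, show (N - (N - 2 * l)) / 2 = l by omega,
    show (N + (N - 2 * l)) / 2 + 1 = N + 1 - l by omega, qubitCoeff_summand_eq_spin_summand hN hl]

end PBT

end

theorem lemma4_general (N : ℕ) (hN : 1 ≤ N) :
    (∀ (d : ℕ), 1 ≤ d → ∀ v : PBT.Frame N d → ℝ, (∀ μ, 0 ≤ v μ) →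
      PBT.fidelity (PBT.resource N d) (PBT.optimalResource v) =
        1 / √((d : ℝ) ^ N) *
          ∑ μ : PBT.Frame N d,
            v μ * √((PBT.dimIrrep μ.1 : ℝ) * (PBT.multIrrep d μ.1 : ℝ))) ∧
    (∀ (v : PBT.Frame N 2 → ℝ) (lam : ℝ), (∀ μ, 0 ≤ v μ) → ∑ μ, v μ ^ 2 = 1 →
      Module.End.HasEigenvector (Matrix.toLin' (PBT.teleportationMatrix N 2)) lam v →
      (∀ (l : ℕ) (hl : 2 * l ≤ N), v (PBT.twoRow N l hl) = PBT.qubitCoeff N l) ∧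
      PBT.fidelity (PBT.resource N 2) (PBT.optimalResource v) =
        1 / √((2 : ℝ) ^ N) *
          ∑ l ∈ Finset.range (N / 2 + 1),
            PBT.qubitCoeff N l * (((N : ℝ) - 2 * l + 1) / √((N : ℝ) + 1)) *
              √((N + 1).choose l : ℝ) ∧
      PBT.fidelity (PBT.resource N 2) (PBT.optimalResource v) =
        √((N.factorial : ℝ) / ((2 : ℝ) ^ ((N : ℤ) - 2) * ((N : ℝ) + 2))) *
          ∑ k ∈ Finset.range (N + 1) with k % 2 = N % 2,
            ((k : ℝ) + 1) * Real.sin (Real.pi * ((k : ℝ) + 1) / ((N : ℝ) + 2)) /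
              √((((N - k) / 2).factorial : ℝ) * (((N + k) / 2 + 1).factorial : ℝ))) := by
  refine ⟨fun d _ v hv0 => PBT.fidelity_resource_optimalResource_of_nonneg hv0,
    fun v lam hv0 hv1 hv => ?_⟩
  have h_coeff (l : ℕ) (hl : 2 * l ≤ N) : v (PBT.twoRow N l hl) = PBT.qubitCoeff N l :=
    (PBT.eigenvector_eq_sineCoeff_div hN hv0 hv1 hv l hl).trans
      (PBT.qubitCoeff_eq_sineCoeff_div hN hl).symm
  have h_fidelity := PBT.fidelity_qubit hv0 h_coeff
  exact ⟨h_coeff, h_fidelity, h_fidelity.trans (PBT.sum_qubitCoeff_eq_sum_spin hN)⟩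

theorem lemma4 (N : ℕ) (hN : 1 ≤ N) :
    (∀ (d : ℕ), 1 ≤ d → ∀ v : PBT.Frame N d → ℝ, PBT.IsOptimalVector v →
      PBT.fidelity (PBT.resource N d) (PBT.optimalResource v) =
        1 / √((d : ℝ) ^ N) *
          ∑ μ : PBT.Frame N d,
            v μ * √((PBT.dimIrrep μ.1 : ℝ) * (PBT.multIrrep d μ.1 : ℝ))) ∧
    (∀ v : PBT.Frame N 2 → ℝ, PBT.IsOptimalVector v →
      (∀ (l : ℕ) (hl : 2 * l ≤ N), v (PBT.twoRow N l hl) = PBT.qubitCoeff N l) ∧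
      PBT.fidelity (PBT.resource N 2) (PBT.optimalResource v) =
        1 / √((2 : ℝ) ^ N) *
          ∑ l ∈ Finset.range (N / 2 + 1),
            PBT.qubitCoeff N l * (((N : ℝ) - 2 * l + 1) / √((N : ℝ) + 1)) *
              √((N + 1).choose l : ℝ) ∧
      -- the index `k` is twice the spin quantum number `j`
      PBT.fidelity (PBT.resource N 2) (PBT.optimalResource v) =
        √((N.factorial : ℝ) / ((2 : ℝ) ^ ((N : ℤ) - 2) * ((N : ℝ) + 2))) *
          ∑ k ∈ Finset.range (N + 1) with k % 2 = N % 2,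
            ((k : ℝ) + 1) * Real.sin (Real.pi * ((k : ℝ) + 1) / ((N : ℝ) + 2)) /
              √((((N - k) / 2).factorial : ℝ) * (((N + k) / 2 + 1).factorial : ℝ))) :=
  (lemma4_general N hN).imp (fun h d hd v hv => h d hd v hv.nonneg)
    fun h v hv => h v _ hv.nonneg hv.normalised hv.eigenvector.choose_spec.1
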